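/- Let $F=F(X)$ be a non-abelian free group of finite rank with basis $X$, and let $H_1,\dots,H_k$ be finitely generated subgroups of $F$ of infinite index. Then there exist $a,b\in F$ such that (1) the subgroup $\mathrm{gp}(a,b)$ of $F$ generated by $a$ and $b$ is free of rank $2$ and malnormal in $F$, that is, $g\,\mathrm{gp}(a,b)\,g^{-1}\cap \mathrm{gp}(a,b)=1$ for every $g\in F\setminus \mathrm{gp}(a,b)$; (2) no nontrivial element of $\mathrm{gp}(a,b)$ is conjugate in $F$ to an element of $H_1\cup\dots\cup H_k$. Moreover, there is an element $y\ne 1$ of $F$, cyclically reduced as a word in $X$, such that no power $y^i$ with $i\neq 0$ is conjugate in $F$ to an element of $H_1\cup\dots\cup H_k$. For every such $y$ there is an element $t\in F$, cyclically reduced as a word in $X$, such that no power $t^i$ with $i\ne 0$ is conjugate in $F$ to a power $y^j$, $j\in\mathbb Z$. For every such $y$ and every such $t$ there is an integer $M$ such that for all $n\ge M$ the elements $a=y^nt^{3n}y^n$ and $b=t^ny^{3n}t^n$ satisfy (1) and (2). -/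

import Mathlib

/-- A subgroup `H` of `G` is malnormal if `g H g⁻¹ ∩ H = 1` for every `g ∈ G` with `g ∉ H`. -/
def IsMalnormal {G : Type*} [Group G] (H : Subgroup G) : Prop :=
  ∀ g : G, g ∉ H → H.map (MulAut.conj g).toMonoidHom ⊓ H = ⊥

/-- The group `G` is free of rank two. -/
def IsFreeOfRankTwo (G : Type*) [Group G] : Prop :=
  Nonempty (FreeGroupBasis (Fin 2) G)

/-- No nontrivial element of `D` is conjugate in `G` to an element of the union of the `H i`. -/
def AvoidsConjugatesOf {G : Type*} [Group G] {k : ℕ} (D : Subgroup G)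
    (H : Fin k → Subgroup G) : Prop :=
  ∀ d ∈ D, d ≠ 1 → ∀ h ∈ ⋃ i, (H i : Set G), ¬ IsConj d h

/-- The pair `a, b` is as wanted for `H 0, …, H (k - 1)`: the subgroup `gp(a, b)` is free of rank
two and malnormal, and none of its nontrivial elements is conjugate into the union of the `H i`. -/
def IsMalnormalPairFor {G : Type*} [Group G] {k : ℕ} (H : Fin k → Subgroup G) (a b : G) : Prop :=
  IsFreeOfRankTwo (Subgroup.closure {a, b}) ∧
    IsMalnormal (Subgroup.closure {a, b}) ∧
    AvoidsConjugatesOf (Subgroup.closure {a, b}) H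

/-- `y` is a nontrivial element of the free group on `X`, represented by a cyclically reduced
word, no nontrivial power of which is conjugate to an element of the union of the `H i`. -/
def IsAdmissibleFirst {X : Type*} [DecidableEq X] {k : ℕ} (H : Fin k → Subgroup (FreeGroup X))
    (y : FreeGroup X) : Prop :=
  y ≠ 1 ∧ FreeGroup.IsCyclicallyReduced y.toWord ∧
    ∀ i : ℤ, i ≠ 0 → ∀ h ∈ ⋃ j, (H j : Set (FreeGroup X)), ¬ IsConj (y ^ i) h

/-- `t` is represented by a cyclically reduced word, and no nontrivial power of `t` is conjugate
to a power of `y`. -/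
def IsAdmissibleSecond {X : Type*} [DecidableEq X] (y t : FreeGroup X) : Prop :=
  FreeGroup.IsCyclicallyReduced t.toWord ∧
    ∀ i j : ℤ, i ≠ 0 → ¬ IsConj (t ^ i) (y ^ j)

/-! The Cayley graph of a free group is a tree, and `ov x a b` is twice the distance from `x` to the
geodesic between `a` and `b`. All the geometry rests on the ultrametric inequality `min_ov_le`.

Let D be the subgroup of the free group on Y, T generated by YT³Y and TY³T, and let ψ send Y, T to
yⁿ, tⁿ. Then gp(a, b) = ψ(D), and the claims split into facts about ψ and facts about D. For large n
little cancels between the syllables, so ψ is injective (`IsSeparated`). Since no nontrivial power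
of t is conjugate to a power of y, pigeonhole shows that a long overlap between translated axes of y
and t occurs only for equal generators and a translating element that commutes with them
(`IsIndependent`). Hence an element g conjugating ψ(w) into the image of ψ is, up to that image, a
power of the generator read along the axis of w times a bounded element of its centralizer
(`exists_eq_mul_of_conj`). If the axis reads Y in one direction and T in the other, comparing the
two descriptions puts g in the image (`mem_range_of_conj`). Every nontrivial element of D has a
conjugate with such an axis (`exists_conj_hasAxisStart_lift_pair`), so malnormality of ψ(D) reduces
to that of D, which is read off a Stallings graph (`mem_range_lift_pair_of_conj`).

Such an axis also contains a long power of y. Finitely generated subgroups are quasiconvex, so an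
element of ψ(D) conjugate into some H i would keep many consecutive powers of y near a translate of
H i, and pigeonhole would conjugate a power of y into H i (`conj_notMem`).

For y, Neumann's lemma on coset coverings gives a word w that no short corrections on either side
bring into any H i; a cyclically reduced word beginning with w works. For t, exponent sums show that
a basis element works. -/

namespace FreeGroup

/-! ### The Cayley tree: word metric and Gromov products -/

section Tree

variable {α : Type*} [DecidableEq α]

/-- The length of the longest common prefix of two lists. -/
def commonPrefixLength {β : Type*} [DecidableEq β] : List β → List β → ℕ
  | a :: l, b :: m => if a = b then commonPrefixLength l m + 1 else 0
  | _, _ => 0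

/-- Prefixes of `b` are nested, so the shorter of the two shared ones is shared by `a` and `c`. This
is the source of 0-hyperbolicity. -/
theorem min_commonPrefixLength_le {β : Type*} [DecidableEq β] (a b c : List β) :
    min (commonPrefixLength a b) (commonPrefixLength b c) ≤ commonPrefixLength a c := by
  induction a generalizing b c with
  | nil => cases b <;> simp [commonPrefixLength]
  | cons x a ih =>
    cases b with
    | nil => simp [commonPrefixLength]
    | cons y b =>
      cases c with
      | nil => simp [commonPrefixLength]
      | cons z c =>
        have := ih b c
        simp only [commonPrefixLength]
        split_ifs <;> simp_all

theorem length_reduce_invRev_append {L M : List (α × Bool)} (hL : IsReduced L)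
    (hM : IsReduced M) :
    (reduce (invRev L ++ M)).length + 2 * commonPrefixLength L M = L.length + M.length := by
  induction L generalizing M with
  | nil => simp [commonPrefixLength, hM.reduce_eq]
  | cons a L ih =>
    cases M with
    | nil =>
      have : IsReduced (invRev (a :: L)) := by
        rw [isReduced_iff_reduce_eq, reduce_invRev, hL.reduce_eq]
      simp [commonPrefixLength, this.reduce_eq]
    | cons b M =>
      have hL' : IsReduced L := hL.infix ⟨[a], [], by simp⟩
      have hM' : IsReduced M := hM.infix ⟨[b], [], by simp⟩
      by_cases hab : a = b
      · subst hab
        have h1 : reduce (invRev (a :: L) ++ a :: M) = reduce (invRev L ++ M) := by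
          apply reduce.sound
          have h2 : invRev (a :: L) = invRev L ++ invRev [a] := by simp [invRev]
          have h3 : a :: M = [a] ++ M := rfl
          rw [h2, h3]
          simp only [← mul_mk, ← inv_mk]
          group
        rw [h1]
        have := ih hL' hM'
        simp [commonPrefixLength]
        omega
      · have h1 : IsReduced (invRev (a :: L) ++ b :: M) := by
          have h2 : IsReduced (invRev (a :: L)) := by
            rw [isReduced_iff_reduce_eq, reduce_invRev, hL.reduce_eq]
          rw [IsReduced, List.isChain_append]
          refine ⟨h2, hM, ?_⟩
          intro x hx y hy
          simp [invRev] at hx hy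
          subst hx hy
          intro h
          by_contra h'
          apply hab
          ext
          · exact h
          · simpa using h'
        rw [h1.reduce_eq]
        simp [commonPrefixLength, hab, invRev_length]

theorem norm_inv_mul_add (g h : FreeGroup α) :
    norm (g⁻¹ * h) + 2 * commonPrefixLength g.toWord h.toWord = norm g + norm h := by
  rw [norm, toWord_mul, toWord_inv]
  exact length_reduce_invRev_append isReduced_toWord isReduced_toWord

/-- The word metric on a free group. -/
def wd (a b : FreeGroup α) : ℤ := norm (a⁻¹ * b)

/-- Twice the Gromov product of `a` and `b` with base point `x`. -/
def ov (x a b : FreeGroup α) : ℤ := wd x a + wd x b - wd a b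

theorem wd_mul_left (c a b : FreeGroup α) : wd (c * a) (c * b) = wd a b := by
  simp [wd, mul_assoc]

theorem ov_mul_left (c x a b : FreeGroup α) : ov (c * x) (c * a) (c * b) = ov x a b := by
  simp [ov, wd_mul_left]

theorem wd_comm (a b : FreeGroup α) : wd a b = wd b a := by
  rw [wd, wd, ← norm_inv_eq]; simp

theorem ov_comm (x a b : FreeGroup α) : ov x a b = ov x b a := by
  simp only [ov, wd_comm b a]; ring

@[simp] theorem wd_self (a : FreeGroup α) : wd a a = 0 := by simp [wd]

theorem wd_nonneg (a b : FreeGroup α) : 0 ≤ wd a b := by simp [wd]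

theorem wd_one_left (a : FreeGroup α) : wd 1 a = norm a := by simp [wd]

theorem wd_mul_right (a b : FreeGroup α) : wd a (a * b) = norm b := by simp [wd]

theorem wd_triangle (a b c : FreeGroup α) : wd a c ≤ wd a b + wd b c := by
  have : a⁻¹ * c = (a⁻¹ * b) * (b⁻¹ * c) := by group
  rw [wd, wd, wd, this]
  exact_mod_cast norm_mul_le (a⁻¹ * b) (b⁻¹ * c)

theorem eq_of_wd_le {a b : FreeGroup α} (h : wd a b ≤ 0) : a = b := by
  have : norm (a⁻¹ * b) = 0 := by
    have := wd_nonneg a b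
    simp only [wd] at *; omega
  rw [norm_eq_zero] at this
  exact (inv_mul_eq_one.1 this)

theorem ov_one_eq (a b : FreeGroup α) :
    ov 1 a b = 2 * commonPrefixLength a.toWord b.toWord := by
  have := norm_inv_mul_add a b
  simp only [ov, wd_one_left]
  simp only [wd]
  omega

/-- Translation moves the base point to `1`, where `ov` is twice the length of a common prefix. -/
theorem min_ov_le (x a b c : FreeGroup α) : min (ov x a b) (ov x b c) ≤ ov x a c := by
  have key : ∀ a b c : FreeGroup α, min (ov 1 a b) (ov 1 b c) ≤ ov 1 a c := by
    intro a b c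
    have := min_commonPrefixLength_le a.toWord b.toWord c.toWord
    rw [ov_one_eq, ov_one_eq, ov_one_eq]
    omega
  have h := key (x⁻¹ * a) (x⁻¹ * b) (x⁻¹ * c)
  have e : ∀ u v : FreeGroup α, ov 1 (x⁻¹ * u) (x⁻¹ * v) = ov x u v := by
    intro u v
    rw [← ov_mul_left x]; simp
  simpa [e] using h

theorem ov_nonneg (x a b : FreeGroup α) : 0 ≤ ov x a b := by
  have := wd_triangle a x b
  rw [wd_comm a x] at this
  simp only [ov]; omega

theorem ov_self (x a : FreeGroup α) : ov x a a = 2 * wd x a := by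
  simp [ov]; ring

theorem ov_le_left (x a b : FreeGroup α) : ov x a b ≤ 2 * wd x a := by
  have := wd_triangle x a b
  simp only [ov]; omega

/-- A point close to the geodesic through `a` and `b` is close to one of the sides of a path. -/
theorem ov_le_or_ov_le {x a b c : FreeGroup α} {C : ℤ} (h : ov x a c ≤ C) :
    ov x a b ≤ C ∨ ov x b c ≤ C := by
  have := min_ov_le x a b c
  omega

theorem ov_one_singleton_pos_iff {g : FreeGroup α} {a : α × Bool} :
    0 < ov 1 g (mk [a]) ↔ g.toWord.head? = some a := by
  rw [ov_one_eq, toWord_mk]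
  have : reduce [a] = [a] := rfl
  rw [this]
  cases g.toWord with
  | nil => simp [commonPrefixLength]
  | cons b l =>
    simp only [commonPrefixLength, List.head?_cons, Option.some.injEq]
    split_ifs with h
    · simp [h]
    · simp [h]

theorem finite_norm_le [Finite α] (R : ℕ) : {g : FreeGroup α | norm g ≤ R}.Finite := by
  have h : {l : List (α × Bool) | l.length ≤ R}.Finite := List.finite_length_le _ _
  exact (h.preimage toWord_injective.injOn).subset fun g hg => hg

/-- The norm of the powers of an element with cyclically reduced word. -/
theorem norm_pow_of_isCyclicallyReduced {x : FreeGroup α} (hx : IsCyclicallyReduced x.toWord)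
    (n : ℕ) : norm (x ^ n) = n * norm x := by
  rw [norm, toWord_pow, (hx.flatten_replicate n).isReduced.reduce_eq]
  simp [norm]

theorem norm_zpow_of_isCyclicallyReduced {x : FreeGroup α} (hx : IsCyclicallyReduced x.toWord)
    (n : ℤ) : (norm (x ^ n) : ℤ) = |n| * norm x := by
  obtain ⟨m, rfl | rfl⟩ := n.eq_nat_or_neg
  · simp [norm_pow_of_isCyclicallyReduced hx]
  · simp [norm_pow_of_isCyclicallyReduced hx]

end Tree

/-! ### Quasiconvexity of finitely generated subgroups, and pigeonhole along axes -/

section Quasiconvexity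

variable {α : Type*} [DecidableEq α]

theorem wd_le_of_ov_le {x a b : FreeGroup α} {C : ℤ} (h : ov x a b ≤ C) :
    2 * wd x a ≤ C + 2 * wd a b := by
  have := wd_triangle x b a
  rw [wd_comm b a] at this
  simp only [ov] at h
  have := wd_nonneg x b
  omega

/-- A point close to a geodesic between elements of `closure S` is close to an edge labelled by an
element of `S`. -/
theorem exists_ov_le_of_mem_closure {S : Set (FreeGroup α)} {h : FreeGroup α}
    (hh : h ∈ Subgroup.closure S) {C : ℤ} {e x : FreeGroup α} (he : e ∈ Subgroup.closure S)
    (hx : ov x e (e * h) ≤ C) :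
    ∃ d ∈ Subgroup.closure S, ∃ c ∈ insert 1 S, ov x d (d * c) ≤ C := by
  induction hh using Subgroup.closure_induction generalizing e with
  | mem c hc => exact ⟨e, he, c, Set.mem_insert_of_mem _ hc, hx⟩
  | one => exact ⟨e, he, 1, Set.mem_insert _ _, hx⟩
  | mul a b ha hb iha ihb =>
    rcases ov_le_or_ov_le (b := e * a) hx with h1 | h1
    · exact iha he h1
    · rw [← mul_assoc] at h1
      exact ihb (mul_mem he ha) h1
  | inv a ha ih =>
    refine ih (mul_mem he (inv_mem ha)) ?_
    rw [ov_comm]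
    simpa using hx

theorem exists_norm_le_of_mem_closure {S : Set (FreeGroup α)} {r : ℕ}
    (hS : ∀ c ∈ S, norm c ≤ r) {h₁ h₂ x : FreeGroup α} {C : ℤ}
    (h₁S : h₁ ∈ Subgroup.closure S) (h₂S : h₂ ∈ Subgroup.closure S) (hx : ov x h₁ h₂ ≤ C) :
    ∃ d ∈ Subgroup.closure S, (norm (d⁻¹ * x) : ℤ) ≤ C + r := by
  obtain ⟨d, hd, c, hc, h⟩ := exists_ov_le_of_mem_closure (C := C) (x := x)
    (mul_mem (inv_mem h₁S) h₂S) h₁S (by simpa using hx)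
  refine ⟨d, hd, ?_⟩
  have h1 := wd_le_of_ov_le h
  have h0 := ov_nonneg x d (d * c)
  have h2 : norm c ≤ r := by
    rcases hc with rfl | hc
    · simp
    · exact hS c hc
  rw [wd_mul_right, wd_comm] at h1
  change wd d x ≤ _
  omega

/-- Finitely generated subgroups of free groups are quasiconvex. -/
theorem exists_norm_le_of_fg {H : Subgroup (FreeGroup α)} (hH : H.FG) :
    ∃ r : ℕ, ∀ (C : ℤ) (h₁ h₂ x : FreeGroup α), h₁ ∈ H → h₂ ∈ H → ov x h₁ h₂ ≤ C →
      ∃ d ∈ H, (norm (d⁻¹ * x) : ℤ) ≤ C + r := by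
  obtain ⟨S, rfl⟩ := hH
  refine ⟨S.sup norm, fun C h₁ h₂ x h1 h2 hx => ?_⟩
  exact exists_norm_le_of_mem_closure (fun c hc => Finset.le_sup (f := norm) hc) h1 h2 hx

/-- The number of elements of norm at most `R`. -/
noncomputable def ballCard (α : Type*) [DecidableEq α] [Finite α] (R : ℕ) : ℕ :=
  (finite_norm_le (α := α) R).toFinset.card

/-- If many consecutive powers of `x` stay close to a translate of `H`, then a nontrivial power of
`x` is conjugate into `H`. -/
theorem exists_conj_pow_mem [Finite α] {H : Subgroup (FreeGroup α)} {g x : FreeGroup α} {R : ℕ}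
    (h : ∀ j ≤ ballCard α R, ∃ d ∈ H, norm (d⁻¹ * (g * x ^ j)) ≤ R) :
    ∃ m : ℤ, m ≠ 0 ∧ g * x ^ m * g⁻¹ ∈ H := by
  choose! d hd hdR using h
  -- There is one exponent more than there are elements in the ball, so two of the corrections `(d
  -- j)⁻¹ * (g * x ^ j)` coincide and cancel in a quotient.
  obtain ⟨i, hi, j, hj, hij, he⟩ := Finset.exists_ne_map_eq_of_card_lt_of_maps_to
    (s := Finset.range (ballCard α R + 1)) (t := (finite_norm_le (α := α) R).toFinset)
    (by simp [ballCard]) (f := fun j => (d j)⁻¹ * (g * x ^ j))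
    (fun j hj => by simpa using hdR j (by simpa [Nat.lt_succ_iff] using hj))
  simp only [Finset.mem_range, Nat.lt_succ_iff] at hi hj
  refine ⟨(i : ℤ) - j, by omega, ?_⟩
  have : g * x ^ ((i : ℤ) - j) * g⁻¹ = d i * (d j)⁻¹ := by
    have h1 : g * x ^ i = d i * ((d j)⁻¹ * (g * x ^ j)) := by
      rw [← he]; group
    rw [zpow_sub, zpow_natCast, zpow_natCast, ← mul_assoc, h1]
    group
  rw [this]
  exact mul_mem (hd i hi) (inv_mem (hd j hj))

/-- The overlap contains the first `ballCard α (2 * R)` powers of `x`. Each lies on the path from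
`1` through `h` to `h * z ^ i`, hence within `2 * R` of the cyclic group generated by `h * z * h⁻¹`,
and pigeonhole applies. -/
theorem exists_zpow_mem_zpowers_of_lt_ov_nat [Finite α] {x h z : FreeGroup α}
    (hx : ∀ n : ℤ, (norm (x ^ n) : ℤ) = |n| * norm x) {R : ℕ} (hh : norm h ≤ R) (hz : norm z ≤ R)
    {i : ℤ} {j : ℕ} (hD : 2 * (ballCard α (2 * R) : ℤ) * norm x < ov 1 (x ^ j) (h * z ^ i)) :
    ∃ m : ℤ, m ≠ 0 ∧ x ^ m ∈ Subgroup.zpowers (h * z * h⁻¹) := by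
  have hx' : ∀ n : ℕ, (norm (x ^ n) : ℤ) = n * norm x := fun n => by simpa using hx n
  have hj : ballCard α (2 * R) ≤ j := by
    by_contra hlt
    have h1 := ov_le_left 1 (x ^ j) (h * z ^ i)
    rw [wd_one_left, hx'] at h1
    push Not at hlt
    have : (j : ℤ) * norm x ≤ ballCard α (2 * R) * norm x := by gcongr
    linarith
  have := exists_conj_pow_mem (H := Subgroup.zpowers (h * z * h⁻¹)) (g := 1) (x := x) (R := 2 * R) ?_
  · simpa using this
  intro k hk
  have h1 : ov 1 (x ^ k) (x ^ j) = 2 * (k * norm x) := by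
    have e : (x ^ k)⁻¹ * x ^ j = x ^ (j - k) := by
      rw [pow_sub x (hk.trans hj)]
      group
    simp only [ov, wd_one_left, hx']
    rw [wd, e, hx']
    push_cast [Nat.cast_sub (hk.trans hj)]
    ring
  have h2 : 2 * (k * norm x) ≤ ov 1 (x ^ k) (h * z ^ i) := by
    have := min_ov_le 1 (x ^ k) (x ^ j) (h * z ^ i)
    have h3 : (k : ℤ) * norm x ≤ ballCard α (2 * R) * norm x := by gcongr
    have h4 : 2 * ((k : ℤ) * norm x) ≤ ov 1 (x ^ j) (h * z ^ i) := by linarith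
    omega
  have h3 : ov (x ^ k) 1 (h * z ^ i) ≤ 0 := by
    simp only [ov, wd_one_left, hx'] at h2
    simp only [ov, wd_comm (x ^ k) 1, wd_one_left, hx']
    linarith
  rcases ov_le_or_ov_le (b := h) h3 with h4 | h4
  · refine ⟨1, one_mem _, ?_⟩
    have := wd_le_of_ov_le h4
    rw [wd_comm, wd_one_left, wd_one_left] at this
    simp only [inv_one, one_mul]
    omega
  · have h5 : ov (h⁻¹ * x ^ k) 1 (z ^ i) ≤ 0 := by
      rw [← ov_mul_left h]
      simpa using h4
    obtain ⟨d, hd, hdr⟩ := exists_norm_le_of_mem_closure (S := {z}) (r := norm z) (by simp)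
      (one_mem _) (zpow_mem (Subgroup.subset_closure (Set.mem_singleton z)) i) h5
    refine ⟨h * d * h⁻¹, ?_, ?_⟩
    · rw [← Subgroup.zpowers_eq_closure] at hd
      obtain ⟨l, rfl⟩ := hd
      refine ⟨l, ?_⟩
      simp
    · have e : (h * d * h⁻¹)⁻¹ * (1 * x ^ k) = h * (d⁻¹ * (h⁻¹ * x ^ k)) := by group
      rw [e]
      have := norm_mul_le h (d⁻¹ * (h⁻¹ * x ^ k))
      omega

/-- A long common prefix of a power of `x` and `h * z ^ i` forces commensurability. -/
theorem exists_zpow_mem_zpowers_of_lt_ov [Finite α] {x h z : FreeGroup α}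
    (hx : ∀ n : ℤ, (norm (x ^ n) : ℤ) = |n| * norm x) {R : ℕ} (hh : norm h ≤ R) (hz : norm z ≤ R)
    {i j : ℤ} (hD : 2 * (ballCard α (2 * R) : ℤ) * norm x < ov 1 (x ^ j) (h * z ^ i)) :
    ∃ m : ℤ, m ≠ 0 ∧ x ^ m ∈ Subgroup.zpowers (h * z * h⁻¹) := by
  obtain ⟨j, rfl | rfl⟩ := j.eq_nat_or_neg
  · exact exists_zpow_mem_zpowers_of_lt_ov_nat hx hh hz (by simpa using hD)
  · obtain ⟨m, hm, h1⟩ := exists_zpow_mem_zpowers_of_lt_ov_nat (x := x⁻¹) (h := h) (z := z)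
      (i := i) (j := j) (fun n => by simpa using hx n) hh hz (by simpa using hD)
    exact ⟨-m, by simpa using hm, by simpa using h1⟩

/-- Conjugation moves geodesics between far away points by a bounded amount. -/
theorem ov_conj_le {q g a b : FreeGroup α} {C : ℤ} (h : ov q a b ≤ C)
    (ha : C + norm q + norm g < norm a) (hb : C + norm q + norm g < norm b) :
    C < ov (g * q) (g * a) (g * a * g⁻¹) ∧ C < ov (g * q) (g * b) (g * b * g⁻¹) ∧
    ov (g * q) (g * a * g⁻¹) (g * b * g⁻¹) ≤ C := by
  have hC : 0 ≤ C := (ov_nonneg q a b).trans h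
  have key : ∀ a, C + norm q + norm g < norm a → C < ov (g * q) (g * a) (g * a * g⁻¹) := by
    intro a ha
    have h1 : wd (g * a) (g * a * g⁻¹) = norm g := by simp [wd_mul_right]
    have h2 := wd_triangle 1 q a
    have h3 := wd_triangle (g * q) (g * a * g⁻¹) (g * a)
    rw [wd_comm (g * a * g⁻¹), h1] at h3
    simp only [ov, h1, wd_mul_left] at h3 ⊢
    simp only [wd_one_left] at h2
    omega
  have h1 := key a ha
  have h2 := key b hb
  refine ⟨h1, h2, ?_⟩
  rw [← ov_mul_left g] at h
  have h3 := min_ov_le (g * q) (g * a) (g * a * g⁻¹) (g * b)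
  have h4 := min_ov_le (g * q) (g * a * g⁻¹) (g * b * g⁻¹) (g * b)
  rw [ov_comm _ (g * b * g⁻¹)] at h4
  omega

theorem exists_lt_norm_pow [Finite α] {u : FreeGroup α} (hu : u ≠ 1) (B : ℕ) :
    ∃ N : ℕ, 1 ≤ N ∧ B < norm (u ^ N) := by
  by_contra! h
  have hinj : Function.Injective fun N : ℕ => u ^ (N + 1) := by
    exact (IsMulTorsionFree.pow_right_injective hu).comp (add_left_injective 1)
  exact Set.infinite_of_injective_forall_mem hinj (s := {g : FreeGroup α | norm g ≤ B})
    (fun N => h (N + 1) (by omega)) (finite_norm_le B)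

/-- Every point of the axis of `u` is moved by `g` close to the subgroup containing `g u g⁻¹`. -/
theorem exists_pow_conj_ov_le [Finite α] {u g q : FreeGroup α} {C : ℤ} (hu : u ≠ 1)
    (h : ∀ N : ℕ, 1 ≤ N → ov q (u ^ N) (u⁻¹ ^ N) ≤ C) :
    ∃ N : ℕ, 1 ≤ N ∧ ov (g * q) ((g * u * g⁻¹) ^ N) ((g * u * g⁻¹)⁻¹ ^ N) ≤ C := by
  -- The ends `u ^ N` and `u⁻¹ ^ N` must be so far out that right multiplication by `g⁻¹` does not
  -- affect the geodesic near `g * q`.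
  obtain ⟨N, hN, hB⟩ := exists_lt_norm_pow hu (C.toNat + norm q + norm g)
  have hC : 0 ≤ C := (ov_nonneg _ _ _).trans (h N hN)
  refine ⟨N, hN, ?_⟩
  have := (ov_conj_le (g := g) (h N hN) (by omega)
    (by rw [inv_pow, norm_inv_eq]; omega)).2.2
  rw [← conj_pow, ← conj_pow] at this
  have e : (g * u * g⁻¹)⁻¹ = g * u⁻¹ * g⁻¹ := by group
  rw [e]
  exact this

end Quasiconvexity

/-! ### Commuting elements and commensurability -/

section Commuting

variable {α : Type*}

theorem exists_forall_mem_zpowers (ι : Type*) [Subsingleton ι] :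
    ∃ c : FreeGroup ι, ∀ x, x ∈ Subgroup.zpowers c := by
  rcases isEmpty_or_nonempty ι with hE | ⟨⟨i⟩⟩
  · exact ⟨1, fun x => by rw [Subsingleton.elim x 1]; exact one_mem _⟩
  · refine ⟨of i, fun x => ?_⟩
    have hr : Set.range (of : ι → FreeGroup ι) = {of i} := by
      ext z
      constructor
      · rintro ⟨j, rfl⟩
        rw [Subsingleton.elim j i]; rfl
      · rintro rfl
        exact ⟨i, rfl⟩
    rw [Subgroup.zpowers_eq_closure, ← hr, closure_range_of]
    trivial

/-- By Nielsen–Schreier the subgroup generated by `a` and `b` is free; being abelian, it has at most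
one free generator. -/
theorem exists_mem_zpowers_of_commute {a b : FreeGroup α} (h : Commute a b) :
    ∃ c : FreeGroup α, a ∈ Subgroup.zpowers c ∧ b ∈ Subgroup.zpowers c := by
  let K := Subgroup.closure {a, b}
  have hcomm : ∀ x y : K, x * y = y * x := by
    have := Subgroup.isMulCommutative_closure (k := {a, b}) (by
      rintro x (rfl | rfl) y (rfl | rfl)
      · rfl
      · exact h
      · exact h.symm
      · rfl)
    exact fun x y => this.is_comm.comm x y
  have hK : IsFreeGroup K := inferInstance
  let e := IsFreeGroup.mulEquiv K
  have hs : ∀ i j : IsFreeGroup.Generators K, i = j := by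
    intro i j
    have h1 : FreeGroup.of i * FreeGroup.of j = FreeGroup.of j * FreeGroup.of i := by
      apply e.injective
      rw [_root_.map_mul, _root_.map_mul, hcomm]
    classical
    have h2 := congrArg toWord h1
    by_contra hij
    simp [toWord_mul, reduce.cons, hij] at h2
  have : Subsingleton (IsFreeGroup.Generators K) := ⟨hs⟩
  have hcyc : ∃ c : K, ∀ x : K, x ∈ Subgroup.zpowers c := by
    obtain ⟨c, hc⟩ := exists_forall_mem_zpowers (IsFreeGroup.Generators K)
    refine ⟨e c, fun x => ?_⟩
    obtain ⟨m, hm⟩ := hc (e.symm x)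
    refine ⟨m, ?_⟩
    apply e.symm.injective
    simpa using hm
  obtain ⟨c, hc⟩ := hcyc
  have hmem : ∀ x (hx : x ∈ K), x ∈ Subgroup.zpowers (c : FreeGroup α) := by
    intro x hx
    obtain ⟨m, hm⟩ := hc ⟨x, hx⟩
    refine ⟨m, ?_⟩
    have := congrArg Subtype.val hm
    simpa using this
  exact ⟨c, hmem a (Subgroup.subset_closure (by simp)), hmem b (Subgroup.subset_closure (by simp))⟩

theorem exists_zpow_eq_zpow_of_commute {a b h : FreeGroup α} (ha : Commute h a)
    (hb : Commute h b) (hh : h ≠ 1) (ha1 : a ≠ 1) :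
    ∃ i j : ℤ, j ≠ 0 ∧ a ^ i = b ^ j := by
  obtain ⟨c, ⟨k, hk⟩, ⟨l, hl⟩⟩ := exists_mem_zpowers_of_commute ha
  obtain ⟨d, ⟨m, hm⟩, ⟨n, hn⟩⟩ := exists_mem_zpowers_of_commute hb
  simp only at hk hl hm hn
  refine ⟨k * n, l * m, ?_, ?_⟩
  · refine mul_ne_zero ?_ ?_
    · rintro rfl; exact ha1 (by simpa using hl.symm)
    · rintro rfl; exact hh (by simpa using hm.symm)
  · have e1 : a ^ (k * n) = h ^ (l * n) := by
      rw [← hl, ← hk, ← zpow_mul, ← zpow_mul]; ring_nf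
    have e2 : b ^ (l * m) = h ^ (l * n) := by
      rw [← hn, ← hm, ← zpow_mul, ← zpow_mul]; ring_nf
    rw [e1, e2]

/-- Linear growth of the powers of `x` forces the two exponents in a relation `h * x ^ k * h⁻¹ = x ^
m` to agree up to sign. Uniqueness of roots then leaves `h * x * h⁻¹ = x` or `h * x * h⁻¹ = x⁻¹`. -/
theorem commute_of_zpow_mem_zpowers [DecidableEq α] {x h : FreeGroup α}
    (hx : ∀ n : ℤ, (norm (x ^ n) : ℤ) = |n| * norm x) {m : ℤ} (hm : m ≠ 0)
    (h1 : x ^ m ∈ Subgroup.zpowers (h * x * h⁻¹)) : Commute h x := by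
  obtain ⟨k, hk⟩ := h1
  simp only [conj_zpow] at hk
  by_cases hx1 : norm x = 0
  · rw [norm_eq_zero] at hx1
    rw [hx1]; exact Commute.one_right h
  have hle : ∀ (p q : ℤ) (g : FreeGroup α), g * x ^ p * g⁻¹ = x ^ q → |q| ≤ |p| := by
    intro p q g hg
    by_contra! hlt
    -- Conjugation by `g` changes norms by at most `2 * norm g`, which the gap between the `N`-th
    -- powers exceeds.
    let N : ℤ := 2 * norm g + 1
    have h2 : x ^ (q * N) = g * x ^ (p * N) * g⁻¹ := by
      rw [zpow_mul, zpow_mul, ← hg, conj_zpow]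
    have h3 := congrArg (fun y => (norm y : ℤ)) h2
    have h4 := norm_mul_le (g * x ^ (p * N)) g⁻¹
    have h5 := norm_mul_le g (x ^ (p * N))
    rw [norm_inv_eq] at h4
    have h6 : (norm (x ^ (q * N)) : ℤ) ≤ 2 * norm g + norm (x ^ (p * N)) := by
      omega
    have hN : |N| = N := abs_of_nonneg (by positivity)
    rw [hx, hx, abs_mul, abs_mul, hN] at h6
    have h7 : (1 : ℤ) ≤ norm x := by omega
    have h8 : (|p| + 1) * N * norm x ≤ |q| * N * norm x := by
      gcongr
      omega
    have h9 : N * 1 ≤ N * norm x := by gcongr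
    have h10 : (|p| + 1) * N * norm x = |p| * N * norm x + N * norm x := by ring
    omega
  have h2 := hle k m h hk
  have h3 := hle m k h⁻¹ (by rw [← hk]; group)
  have h4 : k = m ∨ k = -m := abs_eq_abs.1 (le_antisymm h3 h2)
  rw [← conj_zpow] at hk
  rcases h4 with rfl | rfl
  · have := zpow_left_injective hm hk
    rw [mul_inv_eq_iff_eq_mul] at this
    exact this
  · have h5 : h * x * h⁻¹ = x⁻¹ := by
      apply zpow_left_injective (neg_ne_zero.2 hm)
      simp only [hk, inv_zpow', neg_neg]
    -- In the inverting case `h * h` commutes with `x`, so both sides have the same square.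
    have h6 : x * h * x⁻¹ = h := by
      apply zpow_left_injective two_ne_zero
      have h7 : h * x = x⁻¹ * h := by rw [← h5]; group
      have h8 : h * h * x = x * (h * h) := by
        have : x * h * x = h := by rw [mul_assoc, h7]; group
        calc h * h * x = h * (h * x) := by group
          _ = h * x⁻¹ * h := by rw [h7]; group
          _ = (x * h * x) * x⁻¹ * h := by rw [this]
          _ = x * (h * h) := by group
      have e : x * h * x⁻¹ * (x * h * x⁻¹) = x * (h * h) * x⁻¹ := by group
      simp only [zpow_two]
      rw [e, ← h8]; group
    rw [mul_inv_eq_iff_eq_mul] at h6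
    exact h6.symm

end Commuting

/-! ### Bounded cancellation between letters controls whole words -/

section LocalToGlobal

variable {α ι : Type*}

/-- The image of a letter under the homomorphism extending `s`. -/
def letter (s : ι → FreeGroup α) (l : ι × Bool) : FreeGroup α := lift s (mk [l])

/-- The inverse of a letter. -/
def invLetter (l : ι × Bool) : ι × Bool := (l.1, !l.2)

@[simp] theorem invLetter_invLetter (l : ι × Bool) : invLetter (invLetter l) = l := by
  simp [invLetter]

theorem mk_cons (l : ι × Bool) (L : List (ι × Bool)) : mk (l :: L) = mk [l] * mk L := by
  rw [mul_mk]; rfl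

theorem inv_mk_singleton (l : ι × Bool) : (mk [l])⁻¹ = mk [invLetter l] := by
  simp [inv_mk, invRev, invLetter]

theorem lift_mk_cons (s : ι → FreeGroup α) (l : ι × Bool) (L : List (ι × Bool)) :
    lift s (mk (l :: L)) = letter s l * lift s (mk L) := by
  rw [mk_cons, _root_.map_mul, letter]

theorem inv_letter (s : ι → FreeGroup α) (l : ι × Bool) :
    (letter s l)⁻¹ = letter s (invLetter l) := by
  rw [letter, letter, ← _root_.map_inv, inv_mk_singleton]

variable [DecidableEq α]

/-- The letters have norm more than `C`, and cancellation in products of two letters is at most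
`C / 2`. -/
structure IsSeparated (s : ι → FreeGroup α) (C : ℤ) : Prop where
  nonneg : 0 ≤ C
  lt_norm : ∀ l, C < norm (letter s l)
  ov_le : ∀ l l', l ≠ l' → ov 1 (letter s l) (letter s l') ≤ C

theorem ov_one_mul_self (a p : FreeGroup α) : ov 1 (a * p) a = 2 * norm a - ov 1 a⁻¹ p := by
  have e : wd a⁻¹ p = wd 1 (a * p) := by
    rw [← wd_mul_left a]; simp
  have e2 : wd (a * p) a = wd 1 p := by
    rw [wd_comm, ← wd_mul_left a 1]; simp
  simp only [ov, e, e2]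
  simp only [wd_one_left, norm_inv_eq]
  ring

theorem IsReduced.of_cons {l : ι × Bool} {L : List (ι × Bool)} (h : IsReduced (l :: L)) :
    IsReduced L := h.infix ⟨[l], [], by simp⟩

theorem IsReduced.ne_of_cons {l l' : ι × Bool} {L : List (ι × Bool)} (h : IsReduced (l :: L))
    (h' : L.head? = some l') : invLetter l ≠ l' := by
  rintro rfl
  cases L with
  | nil => simp at h'
  | cons m L =>
    simp at h'
    subst h'
    simp [invLetter] at h

namespace IsSeparated

variable {s : ι → FreeGroup α} {C : ℤ}

/-- By induction the rest of the word cancels at most `C / 2` of the first letter. That letter is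
longer than `C`, so more than `C / 2` of it survives, and this part alone bounds the overlap with
`a⁻¹`. -/
theorem ov_inv_lift_le (hs : IsSeparated s C) {L : List (ι × Bool)} (hL : IsReduced L)
    {a : FreeGroup α} (ha : ∀ l, L.head? = some l → ov 1 a⁻¹ (letter s l) ≤ C) :
    ov 1 a⁻¹ (lift s (FreeGroup.mk L)) ≤ C := by
  induction L generalizing a with
  | nil =>
    have : ov 1 a⁻¹ 1 = 0 := by simp [ov, wd_comm a⁻¹ 1]
    rw [show (FreeGroup.mk [] : FreeGroup ι) = 1 from rfl, _root_.map_one, this]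
    exact hs.nonneg
  | cons l L ih =>
    rw [lift_mk_cons]
    have h1 := ih hL.of_cons (a := letter s l) fun l' hl' => by
      rw [inv_letter]
      exact hs.ov_le _ _ (hL.ne_of_cons hl')
    have h2 := ov_one_mul_self (letter s l) (lift s (FreeGroup.mk L))
    have h3 := ha l rfl
    have h4 := min_ov_le 1 a⁻¹ (letter s l * lift s (FreeGroup.mk L)) (letter s l)
    have h5 := hs.lt_norm l
    omega

/-- The image of a reduced word starts with most of the image of its first letter. -/
theorem le_ov_mul_lift (hs : IsSeparated s C) {L : List (ι × Bool)} (hL : IsReduced L)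
    {a : FreeGroup α} (ha : ∀ l, L.head? = some l → ov 1 a⁻¹ (letter s l) ≤ C) :
    2 * norm a - C ≤ ov 1 (a * lift s (FreeGroup.mk L)) a := by
  have := hs.ov_inv_lift_le hL ha
  rw [ov_one_mul_self]
  omega

variable [DecidableEq ι]

theorem le_ov_lift (hs : IsSeparated s C) {w : FreeGroup ι} {l : ι × Bool}
    (hw : w.toWord.head? = some l) :
    2 * norm (letter s l) - C ≤ ov 1 (lift s w) (letter s l) := by
  obtain ⟨L, hL⟩ : ∃ L, w.toWord = l :: L := by
    cases h : w.toWord with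
    | nil => simp [h] at hw
    | cons m L => simp [h] at hw; exact ⟨L, by rw [hw]⟩
  have hr : IsReduced (l :: L) := hL ▸ isReduced_toWord
  rw [← mk_toWord (x := w), hL, lift_mk_cons]
  refine hs.le_ov_mul_lift hr.of_cons fun l' hl' => ?_
  rw [inv_letter]
  exact hs.ov_le _ _ (hr.ne_of_cons hl')

/-- Each letter is longer than the bound on `ov`, so prefixing it raises the norm by at least one.
-/
theorem norm_le_norm_lift (hs : IsSeparated s C) (w : FreeGroup ι) :
    norm w ≤ norm (lift s w) := by
  have key : ∀ L : List (ι × Bool), IsReduced L → L.length ≤ norm (lift s (FreeGroup.mk L)) := by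
    intro L hL
    induction L with
    | nil => simp
    | cons l L ih =>
      have h1 := ih hL.of_cons
      have h2 := hs.ov_inv_lift_le hL.of_cons (a := letter s l) fun l' hl' => by
        rw [inv_letter]
        exact hs.ov_le _ _ (hL.ne_of_cons hl')
      have h3 := hs.lt_norm l
      rw [lift_mk_cons]
      simp only [ov, wd_one_left, norm_inv_eq] at h2
      simp only [wd, inv_inv] at h2
      simp only [List.length_cons]
      omega
  have := key w.toWord isReduced_toWord
  rwa [mk_toWord] at this

theorem lift_injective (hs : IsSeparated s C) : Function.Injective (lift s) := by
  rw [injective_iff_map_eq_one]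
  intro w hw
  have := hs.norm_le_norm_lift w
  rw [hw, norm_one] at this
  exact norm_eq_zero.1 (by omega)

theorem ov_lift_lift_le (hs : IsSeparated s C) {w w' : FreeGroup ι} {l l' : ι × Bool}
    (hw : w.toWord.head? = some l) (hw' : w'.toWord.head? = some l') (hl : l ≠ l') :
    ov 1 (lift s w) (lift s w') ≤ C := by
  have h1 := hs.le_ov_lift hw
  have h2 := hs.le_ov_lift hw'
  have h3 := hs.lt_norm l
  have h4 := hs.lt_norm l'
  have h5 := hs.ov_le _ _ hl
  have h6 := min_ov_le 1 (letter s l) (lift s w) (letter s l')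
  have h7 := min_ov_le 1 (lift s w) (lift s w') (letter s l')
  rw [ov_comm 1 (letter s l)] at h6
  omega

end IsSeparated

/-- The point `q` lies on the geodesic from `1` to `a`; moving along it towards `a` never increases
the distance to the geodesic from `b` to `a`. -/
theorem ov_le_of_prefix {a b q : FreeGroup α} {C : ℤ} (ha : 2 * (norm q : ℤ) ≤ ov 1 a q)
    (hab : ov 1 a b ≤ C) : ov q a b ≤ C := by
  have h1 := wd_triangle q 1 b
  rw [wd_comm q 1] at h1
  simp only [ov, wd_one_left] at ha hab h1 ⊢
  rw [wd_comm a q] at ha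
  omega

variable [DecidableEq ι]

/-- The positive powers of `w` all start with `l` and the negative ones with `l'`. -/
def HasAxisStart (w : FreeGroup ι) (l l' : ι × Bool) : Prop :=
  ∀ N : ℕ, 1 ≤ N → (w ^ N).toWord.head? = some l ∧ (w⁻¹ ^ N).toWord.head? = some l'

theorem HasAxisStart.inv {w : FreeGroup ι} {l l' : ι × Bool} (h : HasAxisStart w l l') :
    HasAxisStart w⁻¹ l' l := fun N hN => by
  have := h N hN
  rw [inv_inv]
  exact ⟨this.2, this.1⟩

theorem HasAxisStart.ne_one {w : FreeGroup ι} {l l' : ι × Bool} (h : HasAxisStart w l l') :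
    w ≠ 1 := by
  rintro rfl
  have := (h 1 le_rfl).1
  simp at this

/-- An initial segment of the image of the first letter lies on the axis. -/
theorem IsSeparated.ov_pow_le {s : ι → FreeGroup α} {C : ℤ} (hs : IsSeparated s C)
    {w : FreeGroup ι} {l l' : ι × Bool} (hl : l ≠ l') (hw : HasAxisStart w l l') {q : FreeGroup α} (hq : 2 * (norm q : ℤ) ≤ ov 1 (letter s l) q)
    (hq' : 2 * (norm q : ℤ) ≤ 2 * norm (letter s l) - C) {N : ℕ} (hN : 1 ≤ N) :
    2 * (norm q : ℤ) ≤ ov 1 (lift s w ^ N) q ∧ ov 1 (lift s w ^ N) ((lift s w)⁻¹ ^ N) ≤ C ∧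
      ov q (lift s w ^ N) ((lift s w)⁻¹ ^ N) ≤ C := by
  obtain ⟨h1, h2⟩ := hw N hN
  have hA := hs.le_ov_lift h1
  have hAB := hs.ov_lift_lift_le h1 h2 hl
  rw [_root_.map_pow] at hA
  rw [_root_.map_pow, _root_.map_pow, _root_.map_inv] at hAB
  have h3 := min_ov_le 1 (lift s w ^ N) (letter s l) q
  have h4 : 2 * (norm q : ℤ) ≤ ov 1 (lift s w ^ N) q := by omega
  exact ⟨h4, hAB, ov_le_of_prefix h4 hAB⟩

/-- Powers of a cyclically reduced word are plain concatenations, so `l` is its first letter and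
`l'` the inverse of its last. -/
theorem exists_hasAxisStart_of_isCyclicallyReduced {w : FreeGroup ι} (hw : w ≠ 1)
    (h : IsCyclicallyReduced w.toWord) :
    ∃ l l', l ≠ l' ∧ w.toWord.head? = some l ∧ HasAxisStart w l l' := by
  have hne : w.toWord ≠ [] := by simpa using hw
  obtain ⟨l, hl⟩ : ∃ l, w.toWord.head? = some l :=
    ⟨_, List.head?_eq_some_head hne⟩
  obtain ⟨m, hm⟩ : ∃ m, w.toWord.getLast? = some m :=
    ⟨_, List.getLast?_eq_some_getLast hne⟩
  refine ⟨l, invLetter m, ?_, hl, fun N hN => ?_⟩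
  · rintro rfl
    have := h.2 m hm _ hl rfl
    simp [invLetter] at this
  · have hp : (w ^ N).toWord = (List.replicate N w.toWord).flatten := by
      rw [toWord_pow, (h.flatten_replicate N).isReduced.reduce_eq]
    have hN : N ≠ 0 := by omega
    constructor
    · rw [hp, List.head?_flatten_replicate hN, hl]
    · rw [inv_pow, toWord_inv, hp, invRev]
      rw [List.head?_reverse, List.getLast?_map, List.getLast?_flatten_replicate hN, hm]
      rfl

theorem exists_conj_hasAxisStart {w : FreeGroup ι} (hw : w ≠ 1) :
    ∃ c l l', l ≠ l' ∧ HasAxisStart (c⁻¹ * w * c) l l' := by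
  let c : FreeGroup ι := mk (reduceCyclically.conjugator w.toWord)
  let r : FreeGroup ι := mk (reduceCyclically w.toWord)
  have hcyc := reduceCyclically.isCyclicallyReduced (isReduced_toWord (x := w))
  have hr : r.toWord = reduceCyclically w.toWord := by
    rw [toWord_mk, hcyc.isReduced.reduce_eq]
  have hcr : c * r * c⁻¹ = w := by
    conv_rhs => rw [← mk_toWord (x := w),
      ← reduceCyclically.conj_conjugator_reduceCyclically w.toWord]
    simp [c, r, ← mul_mk, inv_mk, mul_assoc]
  have hr1 : r ≠ 1 := by
    intro h
    apply hw
    rw [← hcr, h]; simp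
  obtain ⟨l, l', h1, -, h2⟩ := exists_hasAxisStart_of_isCyclicallyReduced hr1 (hr ▸ hcyc)
  refine ⟨c, l, l', h1, ?_⟩
  rw [← hcr]
  convert h2 using 1
  group

end LocalToGlobal

/-! ### Axes of elements generated by large powers -/

section Axes

variable {α : Type*}

/-- The exponent `1` or `-1` of a letter. -/
def boolSign (b : Bool) : ℤ := cond b 1 (-1)

theorem abs_boolSign (b : Bool) : |boolSign b| = 1 := by cases b <;> rfl

theorem boolSign_not (b : Bool) : boolSign (!b) = -boolSign b := by cases b <;> rfl

theorem letter_pow {ι : Type*} (x : ι → FreeGroup α) (n : ℕ) (l : ι × Bool) :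
    letter (fun i => x i ^ n) l = (x l.1 ^ boolSign l.2) ^ n := by
  obtain ⟨i, b⟩ := l
  cases b <;> simp [letter, boolSign, lift_mk]

variable [DecidableEq α]

section Powers

variable {x : FreeGroup α} (hx : ∀ n : ℤ, (norm (x ^ n) : ℤ) = |n| * norm x)
include hx

theorem ov_zpow_of_mul_nonpos {a b : ℤ} (hab : a * b ≤ 0) : ov 1 (x ^ a) (x ^ b) = 0 := by
  have e : (x ^ a)⁻¹ * x ^ b = x ^ (b - a) := by rw [← zpow_neg, ← zpow_add]; ring_nf
  simp only [ov, wd_one_left, hx]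
  rw [wd, e, hx]
  have : |b - a| = |a| + |b| := by
    rcases abs_cases a with h1 | h1 <;> rcases abs_cases b with h2 | h2 <;>
      rcases abs_cases (b - a) with h3 | h3 <;> nlinarith
  rw [this]; ring

theorem ov_pow_pow {b : Bool} {i j : ℕ} (hij : i ≤ j) :
    ov 1 ((x ^ boolSign b) ^ j) ((x ^ boolSign b) ^ i) = 2 * (i * norm x) := by
  have e : ((x ^ boolSign b) ^ i)⁻¹ * (x ^ boolSign b) ^ j = x ^ (boolSign b * ((j - i : ℕ) : ℤ)) := by
    rw [zpow_mul, zpow_natCast, pow_sub _ hij]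
    group
  have h : ∀ k : ℕ, (norm ((x ^ boolSign b) ^ k) : ℤ) = k * norm x := by
    intro k
    rw [← zpow_natCast, ← zpow_mul, hx, abs_mul, abs_boolSign]
    simp
  rw [ov_comm]
  simp only [ov, wd_one_left, h]
  rw [wd, e, hx, abs_mul, abs_boolSign]
  push_cast [hij]
  rw [abs_of_nonneg (by omega)]
  ring

theorem norm_boolSign_pow (b : Bool) (k : ℕ) : (norm ((x ^ boolSign b) ^ k) : ℤ) = k * norm x := by
  rw [← zpow_natCast, ← zpow_mul, hx, abs_mul, abs_boolSign]
  simp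

end Powers

/-- The elements `x i` have linearly growing powers, and the axes of translates of distinct `x i`
have short overlaps. -/
structure IsIndependent (x : Fin 2 → FreeGroup α) (C D : ℤ) (R : ℕ) : Prop where
  nonneg : 0 ≤ C
  nonneg' : 0 ≤ D
  norm_zpow : ∀ i (n : ℤ), (norm (x i ^ n) : ℤ) = |n| * norm (x i)
  pos : ∀ i, 1 ≤ norm (x i)
  ov_le : ∀ i j, i ≠ j → ∀ a b : ℤ, ov 1 (x i ^ a) (x j ^ b) ≤ C
  le_radius : ∀ i, C + norm (x i) ≤ R
  commute : ∀ k i h, norm h ≤ R → ∀ a b : ℤ, D < ov 1 (x k ^ a) (h * x i ^ b) →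
    k = i ∧ Commute h (x i)

namespace IsIndependent

variable {x : Fin 2 → FreeGroup α} {C D : ℤ} {R n : ℕ}

theorem ov_pow_letter_le (hx : IsIndependent x C D R) {k l : Fin 2 × Bool} (hkl : k ≠ l) (a : ℕ) :
    ov 1 ((x k.1 ^ boolSign k.2) ^ a) (letter (fun i => x i ^ n) l) ≤ C := by
  rw [letter_pow]
  simp only [← zpow_natCast, ← zpow_mul]
  by_cases h : k.1 = l.1
  · have h2 : k.2 = !l.2 := by
      by_contra h2
      apply hkl
      ext
      · rw [h]
      · simpa using h2
    rw [h, h2, boolSign_not, ov_zpow_of_mul_nonpos (hx.norm_zpow _)]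
    · exact hx.nonneg
    · have : -boolSign l.2 * a * (boolSign l.2 * n) = -(boolSign l.2 ^ 2 * (a * n)) := by ring
      rw [this]
      simp only [Left.neg_nonpos_iff]
      positivity
  · exact hx.ov_le _ _ h _ _

theorem isSeparated (hx : IsIndependent x C D R) (hn : C < n) :
    IsSeparated (fun i => x i ^ n) C where
  nonneg := hx.nonneg
  lt_norm l := by
    rw [letter_pow, norm_boolSign_pow (hx.norm_zpow _)]
    have := hx.pos l.1
    nlinarith
  ov_le l l' hl := by
    rw [letter_pow (l := l)]
    exact hx.ov_pow_letter_le hl n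

theorem le_ov_pow_mul_lift (hx : IsIndependent x C D R) (hn : C < n) {k : Fin 2 × Bool}
    {L : List (Fin 2 × Bool)} (hL : IsReduced (k :: L)) (a : ℕ) :
    2 * (a * norm (x k.1) : ℤ) - C ≤
      ov 1 ((x k.1 ^ boolSign k.2) ^ a * lift (fun i => x i ^ n) (FreeGroup.mk L))
        ((x k.1 ^ boolSign k.2) ^ a) := by
  rw [← norm_boolSign_pow (hx.norm_zpow _) k.2]
  refine (hx.isSeparated hn).le_ov_mul_lift hL.of_cons fun l hl => ?_
  have h1 := hx.ov_pow_letter_le (n := n) (hL.ne_of_cons hl) a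
  have e : ((x k.1 ^ boolSign k.2) ^ a)⁻¹ = (x (invLetter k).1 ^ boolSign (invLetter k).2) ^ a := by
    simp [invLetter, boolSign_not]
  rw [e]
  exact h1

end IsIndependent

/-- The path is cut into images of letters. The hypothesis `hP` keeps `c` away from the start, which
excludes the empty path. -/
theorem exists_ov_le_letter {ι : Type*} {s : ι → FreeGroup α} {c : FreeGroup α} {C : ℤ}
    (L : List (ι × Bool)) {P : FreeGroup α} (hP : C < 2 * wd c P)
    (h : ov c P (P * lift s (mk L)) ≤ C) :
    ∃ L₁ l L₂, L = L₁ ++ l :: L₂ ∧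
      ov c (P * lift s (mk L₁)) (P * lift s (mk L₁) * letter s l) ≤ C := by
  have hnil : lift s (mk []) = 1 := _root_.map_one _
  induction L generalizing P with
  | nil => rw [hnil, mul_one, ov_self] at h; omega
  | cons l L ih =>
    by_cases h1 : ov c P (P * letter s l) ≤ C
    · refine ⟨[], l, L, rfl, ?_⟩
      rwa [hnil, mul_one]
    · rw [lift_mk_cons, ← mul_assoc] at h
      have h2 := (ov_le_or_ov_le h).resolve_left h1
      have h3 := ov_le_left c (P * letter s l) P
      rw [ov_comm] at h3
      obtain ⟨L₁, m, L₂, rfl, h4⟩ := ih (by omega) h2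
      refine ⟨l :: L₁, m, L₂, rfl, ?_⟩
      rwa [lift_mk_cons, ← mul_assoc]

theorem exists_wd_pow_le {c P z : FreeGroup α} {C : ℤ} {n : ℕ} (h : ov c P (P * z ^ n) ≤ C) :
    ∃ i ≤ n, 2 * wd c (P * z ^ i) ≤ C + 2 * norm z := by
  induction n with
  | zero =>
    refine ⟨0, le_rfl, ?_⟩
    rw [pow_zero, mul_one, ov_self] at h
    rw [pow_zero, mul_one]
    omega
  | succ n ih =>
    rcases ov_le_or_ov_le (b := P * z ^ n) h with h1 | h1
    · obtain ⟨i, hi, h2⟩ := ih h1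
      exact ⟨i, by omega, h2⟩
    · refine ⟨n, by omega, ?_⟩
      have := wd_le_of_ov_le h1
      rwa [pow_succ, ← mul_assoc, wd_mul_right] at this

/-- Two lines with close ends and close base points have a long overlap. -/
theorem lt_ov_of_near {g p q e r a : FreeGroup α} {C D : ℤ} {R : ℕ}
    (hR : norm (p⁻¹ * (g * q)) ≤ R) (ha : D + C < 2 * norm a) (hr : D + C + 2 * R < 2 * norm r)
    (h₁ : 2 * norm a - C ≤ ov p (g * e * g⁻¹) (p * a))
    (h₂ : 2 * norm r - C ≤ ov q e (q * r))
    (he : D + 2 * (norm q + R + norm g) < 2 * norm e) :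
    D < ov 1 a (p⁻¹ * (g * q) * r) := by
  have hR' : wd p (g * q) ≤ R := by rw [wd]; exact_mod_cast hR
  rw [← ov_mul_left p, mul_one]
  have e1 : p * (p⁻¹ * (g * q) * r) = g * (q * r) := by group
  rw [e1]
  rw [← ov_mul_left g] at h₂
  have h3 : ov (g * q) (g * e) (g * (q * r)) - 2 * R ≤ ov p (g * e) (g * (q * r)) := by
    have t1 := wd_triangle (g * q) p (g * e)
    have t2 := wd_triangle (g * q) p (g * (q * r))
    rw [wd_comm (g * q) p] at t1 t2
    simp only [ov]
    omega
  have hg : wd (g * e) (g * e * g⁻¹) = norm g := by simp [wd_mul_right]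
  have h4 : D < ov p (g * e * g⁻¹) (g * e) := by
    have t1 := wd_triangle (g * q) p (g * e)
    have t2 := wd_triangle p (g * e * g⁻¹) (g * e)
    have t3 := wd_triangle 1 q e
    rw [wd_comm (g * q) p, wd_mul_left] at t1
    rw [wd_comm (g * e * g⁻¹) (g * e), hg] at t2
    simp only [wd_one_left] at t3
    simp only [ov]
    rw [wd_comm (g * e * g⁻¹) (g * e), hg]
    omega
  have m1 := min_ov_le p (p * a) (g * e * g⁻¹) (g * (q * r))
  have m2 := min_ov_le p (g * e * g⁻¹) (g * e) (g * (q * r))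
  rw [ov_comm p (p * a) (g * e * g⁻¹)] at m1
  omega

namespace IsIndependent

variable {x : Fin 2 → FreeGroup α} {C D : ℤ} {R n : ℕ}

/-- The margin `m + C ≤ n` keeps the chosen power clear of the end of the first syllable, where
cancellation may occur. -/
theorem ov_pow_le (hx : IsIndependent x C D R) (hn : C < n) {w : FreeGroup (Fin 2)}
    {l l' : Fin 2 × Bool} (hl : l ≠ l') (hw : HasAxisStart w l l') {m : ℕ} (hm : m + C ≤ n)
    {N : ℕ} (hN : 1 ≤ N) :
    2 * norm ((x l.1 ^ boolSign l.2) ^ m) ≤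
        ov 1 (lift (fun i => x i ^ n) w ^ N) ((x l.1 ^ boolSign l.2) ^ m) ∧
      ov 1 (lift (fun i => x i ^ n) w ^ N) ((lift (fun i => x i ^ n) w)⁻¹ ^ N) ≤ C ∧
      ov ((x l.1 ^ boolSign l.2) ^ m) (lift (fun i => x i ^ n) w ^ N)
        ((lift (fun i => x i ^ n) w)⁻¹ ^ N) ≤ C := by
  have hC := hx.nonneg
  have hpos := hx.pos l.1
  have hn' : (norm (letter (fun i => x i ^ n) l) : ℤ) = n * norm (x l.1) := by
    rw [letter_pow, norm_boolSign_pow (hx.norm_zpow _)]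
  refine (hx.isSeparated hn).ov_pow_le hl hw ?_ ?_ hN
  · rw [letter_pow, ov_pow_pow (hx.norm_zpow _) (by omega), norm_boolSign_pow (hx.norm_zpow _)]
  · rw [hn', norm_boolSign_pow (hx.norm_zpow _)]
    have h5 : ((m : ℤ) + C) * norm (x l.1) ≤ n * norm (x l.1) := by gcongr
    have h6 : C * 1 ≤ C * norm (x l.1) := by gcongr; omega
    rw [add_mul] at h5
    omega

set_option maxHeartbeats 1000000 in
/-- If the axis of an element of the subgroup generated by large powers of the `x i` is moved by `g`
to the axis of another such element, then `g` is up to this subgroup a bounded element of the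
centralizer of `x i` times a power of `x i`. -/
theorem exists_eq_mul_of_conj [Finite α] (hx : IsIndependent x C D R)
    (hn : C + 2 < n) (hnD : D + 2 * C + 2 * R + 2 < n)
    {w v : FreeGroup (Fin 2)} {l l' : Fin 2 × Bool} (hl : l ≠ l') (hw : HasAxisStart w l l')
    {g : FreeGroup α}
    (hg : g * lift (fun i => x i ^ n) w * g⁻¹ = lift (fun i => x i ^ n) v) :
    ∃ (u : FreeGroup (Fin 2)) (m : ℤ) (h : FreeGroup α), Commute h (x l.1) ∧ norm h ≤ R ∧
      g = lift (fun i => x i ^ n) u * x l.1 ^ m * h := by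
  have hn' : C < n := by omega
  have hs := hx.isSeparated hn'
  set ψ := lift (fun i => x i ^ n) with hψ
  have hw1 : ψ w ≠ 1 := by
    intro h
    exact hw.ne_one (hs.lift_injective (by rw [← hψ, h, _root_.map_one]))
  have hC := hx.nonneg
  have hD := hx.nonneg'
  -- Taking `q` in the middle of the first syllable leaves about half of the syllable on either side
  -- for comparison.
  let m := n / 2
  have hm : 2 * m ≤ n ∧ n ≤ 2 * m + 1 := by omega
  set q := (x l.1 ^ boolSign l.2) ^ m with hq
  obtain ⟨N, hN, hbig⟩ := exists_lt_norm_pow hw1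
    ((C + D).toNat + C.toNat + D.toNat + norm q + R + norm g)
  obtain ⟨hAq, hAB, hqAB⟩ := hx.ov_pow_le hn' hl hw (m := m) (by omega) hN
  have hAl := hs.le_ov_lift (hw N hN).1
  rw [_root_.map_pow] at hAl
  rw [← hψ, ← hq] at hAq hqAB
  rw [← hψ] at hAB hAl
  set A := ψ w ^ N with hA
  have hB : (ψ w)⁻¹ ^ N = A⁻¹ := by rw [inv_pow]
  rw [hB] at hqAB hAB
  have hnB : norm A⁻¹ = norm A := norm_inv_eq
  obtain ⟨hcA, hcB, hcAB⟩ := ov_conj_le (g := g) hqAB (by omega)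
    (by rw [hnB]; omega)
  -- The translated axis joins `ψ (v⁻¹ ^ N)` to `ψ (v ^ N)`, so it can also be followed syllable by
  -- syllable along `v ^ (2 * N)`.
  have hA' : g * A * g⁻¹ = g * A⁻¹ * g⁻¹ * ψ (v ^ (2 * N)) := by
    have e1 : ψ (v ^ (2 * N)) = (g * A * g⁻¹) * (g * A * g⁻¹) := by
      rw [_root_.map_pow, ← hg, hA, conj_pow, two_mul, pow_add]; group
    rw [e1]; group
  have hqn : (norm q : ℤ) = m * norm (x l.1) := norm_boolSign_pow (hx.norm_zpow _) _ _
  have hposl := hx.pos l.1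
  have hmn : (m : ℤ) * 1 ≤ m * norm (x l.1) := by gcongr; omega
  -- the point of the axis of `v` near `g * q`
  have hfar : C < 2 * wd (g * q) (g * A⁻¹ * g⁻¹) := by
    have t1 := ov_le_left (g * q) (g * A⁻¹ * g⁻¹) (g * A⁻¹)
    rw [ov_comm] at t1
    omega
  have hov : ov (g * q) (g * A⁻¹ * g⁻¹) (g * A⁻¹ * g⁻¹ * ψ (FreeGroup.mk (v ^ (2 * N)).toWord)) ≤ C := by
    rw [mk_toWord, ← hA', ov_comm]
    exact hcAB
  obtain ⟨L₁, k, L₂, hL, hk⟩ := exists_ov_le_letter _ hfar hov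
  have hred : IsReduced (L₁ ++ k :: L₂) := hL ▸ isReduced_toWord
  rw [letter_pow] at hk
  obtain ⟨i, hi, hnear⟩ := exists_wd_pow_le hk
  set z := x k.1 ^ boolSign k.2 with hz
  set p := g * A⁻¹ * g⁻¹ * ψ (FreeGroup.mk L₁) * z ^ i with hp
  have hnz : norm z = norm (x k.1) := by
    have := norm_boolSign_pow (hx.norm_zpow k.1) k.2 1
    rw [pow_one] at this
    rw [hz]; omega
  have hh : norm (p⁻¹ * (g * q)) ≤ R := by
    have h1 := hx.le_radius k.1
    rw [wd_comm, hnz, wd] at hnear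
    omega
  have hposk := hx.pos k.1
  have hfin : k.1 = l.1 ∧ Commute (p⁻¹ * (g * q)) (x l.1) := by
    -- The point `p` cuts its syllable into exponents `i` and `n - i`. A piece of about half the
    -- syllable is compared with the axis through `g * q`: forwards if `n - i` is large, backwards
    -- otherwise.
    by_cases hik : m ≤ n - i
    · have e1 : g * A * g⁻¹ = p * (z ^ (n - i) * ψ (FreeGroup.mk L₂)) := by
        rw [hA', ← mk_toWord (x := v ^ (2 * N)), hL, hp, ← mul_mk, _root_.map_mul, lift_mk_cons,
          letter_pow, ← hz, ← hψ, ← pow_mul_pow_sub z hi]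
        group
      have h1 := hx.le_ov_pow_mul_lift hn' (k := k) (L := L₂) (hred.infix ⟨L₁, [], by simp⟩) (n - i)
      rw [← ov_mul_left p, mul_one, ← hψ, ← hz, ← e1] at h1
      have hna : (norm (z ^ (n - i)) : ℤ) = (n - i : ℕ) * norm (x k.1) :=
        norm_boolSign_pow (hx.norm_zpow _) _ _
      have hnr : (norm ((x l.1 ^ boolSign l.2) ^ (n - m)) : ℤ) = (n - m : ℕ) * norm (x l.1) :=
        norm_boolSign_pow (hx.norm_zpow _) _ _
      have h3 : ((n - i : ℕ) : ℤ) * 1 ≤ (n - i : ℕ) * norm (x k.1) := by gcongr; omega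
      have h4 : ((n - m : ℕ) : ℤ) * 1 ≤ (n - m : ℕ) * norm (x l.1) := by gcongr; omega
      have e2 : letter (fun i => x i ^ n) l = q * (x l.1 ^ boolSign l.2) ^ (n - m) := by
        rw [letter_pow, hq, pow_mul_pow_sub _ (by omega)]
      have hnl : (norm (letter (fun i => x i ^ n) l) : ℤ) = norm q +
          norm ((x l.1 ^ boolSign l.2) ^ (n - m)) := by
        rw [letter_pow, norm_boolSign_pow (hx.norm_zpow _), hqn, hnr]
        push_cast [show m ≤ n by omega]
        ring
      have h2 : 2 * norm ((x l.1 ^ boolSign l.2) ^ (n - m)) - C ≤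
          ov q A (q * (x l.1 ^ boolSign l.2) ^ (n - m)) := by
        rw [hnl, e2] at hAl
        have t1 := wd_triangle 1 q A
        rw [wd_one_left, wd_one_left] at t1
        simp only [ov, wd_one_left, wd_mul_right] at hAl ⊢
        rw [e2] at hnl
        omega
      have := lt_ov_of_near (D := D) (C := C) (a := z ^ (n - i)) hh (by omega) (by omega)
        (by rw [hna]; exact h1) h2 (by omega)
      simp only [hz, ← zpow_natCast, ← zpow_mul] at this
      exact hx.commute _ _ _ hh _ _ this
    · have e1 : g * A⁻¹ * g⁻¹ = p * ((z⁻¹) ^ i * ψ (FreeGroup.mk (invRev L₁))) := by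
        rw [hp, ← inv_mk, _root_.map_inv]
        group
      have hred' : IsReduced (invLetter k :: invRev L₁) := by
        have h1 : IsReduced (L₁ ++ [k]) := hred.infix ⟨[], L₂, by simp⟩
        have h2 : IsReduced (invRev (L₁ ++ [k])) := by
          rw [isReduced_iff_reduce_eq, reduce_invRev, h1.reduce_eq]
        simpa [invRev, invLetter] using h2
      have h1 := hx.le_ov_pow_mul_lift hn' hred' i
      have hz' : x (invLetter k).1 ^ boolSign (invLetter k).2 = z⁻¹ := by
        simp [invLetter, boolSign_not, hz]
      rw [← ov_mul_left p, mul_one, ← hψ, hz', ← e1] at h1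
      have hna : (norm (z⁻¹ ^ i) : ℤ) = i * norm (x k.1) := by
        rw [inv_pow, norm_inv_eq]
        exact norm_boolSign_pow (hx.norm_zpow _) _ _
      have h3 : (i : ℤ) * 1 ≤ i * norm (x k.1) := by gcongr; omega
      have h2 : 2 * norm q⁻¹ - C ≤ ov q A⁻¹ (q * q⁻¹) := by
        have t1 := min_ov_le 1 A q A⁻¹
        have t2 : ov 1 q A⁻¹ ≤ C := by omega
        rw [mul_inv_cancel, norm_inv_eq]
        simp only [ov, wd_one_left] at t2 ⊢
        rw [wd_comm q 1, wd_comm A⁻¹ 1, wd_one_left, wd_one_left]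
        omega
      have := lt_ov_of_near (D := D) (C := C) (a := z⁻¹ ^ i) hh (by omega)
        (by rw [norm_inv_eq]; omega) (by rw [hna]; exact h1) h2 (by omega)
      have e3 : z⁻¹ ^ i = x k.1 ^ (-(boolSign k.2 * i)) := by
        rw [hz, zpow_neg, zpow_mul, zpow_natCast, inv_pow]
      have e4 : q⁻¹ = x l.1 ^ (-(boolSign l.2 * m)) := by
        rw [hq, zpow_neg, zpow_mul, zpow_natCast]
      rw [e3, e4] at this
      exact hx.commute _ _ _ hh _ _ this
  obtain ⟨hkl, hcomm⟩ := hfin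
  refine ⟨v⁻¹ ^ N * FreeGroup.mk L₁, boolSign k.2 * i + -(boolSign l.2 * m), _, hcomm, hh, ?_⟩
  have e3 : z ^ i = x l.1 ^ (boolSign k.2 * i) := by
    rw [hz, hkl, zpow_mul, zpow_natCast]
  have e4 : q = x l.1 ^ (boolSign l.2 * m) := by
    rw [hq, zpow_mul, zpow_natCast]
  have e5 : ψ (v⁻¹ ^ N * FreeGroup.mk L₁) * x l.1 ^ (boolSign k.2 * (i : ℤ)) = p := by
    rw [← e3, hp, _root_.map_mul, _root_.map_pow, _root_.map_inv, ← hg, hA]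
    congr 2
    rw [inv_pow, conj_pow]
    group
  have e6 := (hcomm.zpow_right (boolSign l.2 * m)).eq
  rw [← e4] at e6
  -- Since `p⁻¹ * (g * q)` commutes with `q`, the final `q⁻¹` can be moved in front of it.
  calc g = p * q⁻¹ * (q * (p⁻¹ * (g * q))) * q⁻¹ := by group
    _ = p * q⁻¹ * (p⁻¹ * (g * q) * q) * q⁻¹ := by rw [e6]
    _ = p * q⁻¹ * (p⁻¹ * (g * q)) := by group
    _ = _ := by rw [zpow_add, ← mul_assoc (ψ _), e5, zpow_neg, ← e4]

end IsIndependent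

end Axes

/-! ### Conjugators of elements whose axes pass between the two generators -/

theorem exists_eq_mk_mul {ι : Type*} [DecidableEq ι] {w : FreeGroup ι} {l : ι × Bool}
    (h : w.toWord.head? = some l) : ∃ w', w = mk [l] * w' ∧ norm w = norm w' + 1 := by
  obtain ⟨L, hL⟩ : ∃ L, w.toWord = l :: L := by
    cases h' : w.toWord with
    | nil => simp [h'] at h
    | cons m L => simp [h'] at h; exact ⟨L, by rw [h]⟩
  have hr : IsReduced (l :: L) := hL ▸ isReduced_toWord
  refine ⟨mk L, ?_, ?_⟩
  · rw [← mk_toWord (x := w), hL, mk_cons]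
  · rw [norm, norm, hL, toWord_mk, hr.of_cons.reduce_eq]; rfl

theorem exists_head?_eq_some {ι : Type*} [DecidableEq ι] {w : FreeGroup ι} (h : w ≠ 1) :
    ∃ l, w.toWord.head? = some l :=
  ⟨_, List.head?_eq_some_head (by simpa using h)⟩

namespace IsIndependent

variable {α : Type*} [DecidableEq α] {x : Fin 2 → FreeGroup α} {C D : ℤ} {R n : ℕ}

theorem eq_one_of_commute (hx : IsIndependent x C D R) {i j : Fin 2} (hij : i ≠ j)
    {h : FreeGroup α} (hi : Commute h (x i)) (hj : Commute h (x j)) : h = 1 := by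
  by_contra hh
  have hi1 : x i ≠ 1 := fun h => by
    have := hx.pos i
    rw [h, norm_one] at this
    omega
  obtain ⟨a, b, hb, hab⟩ := exists_zpow_eq_zpow_of_commute hi hj hh hi1
  have hC := hx.nonneg
  -- The factor `C + 1` makes the common power longer than the permitted overlap.
  have h1 := hx.ov_le i j hij (a * (C + 1)) (b * (C + 1))
  rw [zpow_mul, zpow_mul, hab, ov_self, wd_one_left, ← zpow_mul, hx.norm_zpow, abs_mul,
    abs_of_nonneg (show 0 ≤ C + 1 by omega)] at h1
  have h2 : 1 * (C + 1) * 1 ≤ |b| * (C + 1) * norm (x j) := by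
    have := hx.pos j
    have := Int.one_le_abs hb
    gcongr
    omega
  omega

theorem ov_zpow_mul_le (hx : IsIndependent x C D R) {i : Fin 2} {l : Fin 2 × Bool} (hil : i ≠ l.1)
    {h : FreeGroup α} (hh : norm h ≤ R) (m : ℤ) :
    ov 1 (x i ^ m * h) (letter (fun i => x i ^ n) l) ≤ C + 2 * R := by
  have h1 := hx.ov_le i l.1 hil m (boolSign l.2 * n)
  rw [zpow_mul, zpow_natCast, ← letter_pow] at h1
  have h2 := wd_triangle 1 (x i ^ m) (x i ^ m * h)
  have h3 := wd_triangle (x i ^ m) (x i ^ m * h) (letter (fun i => x i ^ n) l)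
  rw [wd_mul_right] at h2 h3
  simp only [ov] at h1 ⊢
  omega

/-- Leading syllables of `w` in `x i` are absorbed into `m`, and trailing ones in `x j` into `m'`.
When neither kind is left, `w` is trivial, or its image is too long for the product on the right. -/
theorem mem_range_of_eq_mul (hx : IsIndependent x C D R) (hn : 2 * C + 2 * R < n) {i j : Fin 2}
    (hij : i ≠ j) {h h' : FreeGroup α} (hh : norm h ≤ R) (hh' : norm h' ≤ R)
    (hc : Commute h (x i)) (hc' : Commute h' (x j)) (k : ℕ) :
    ∀ (w : FreeGroup (Fin 2)) (m m' : ℤ), norm w ≤ k →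
      lift (fun i => x i ^ n) w = x i ^ m * h * (x j ^ m' * h')⁻¹ →
      x i ^ m * h ∈ (lift (fun i => x i ^ n)).range := by
  have hC := hx.nonneg
  have hs := hx.isSeparated (n := n) (by omega)
  have hle : ∀ l, (n : ℤ) ≤ norm (letter (fun i => x i ^ n) l) := by
    intro l
    rw [letter_pow, norm_boolSign_pow (hx.norm_zpow _)]
    have := hx.pos l.1
    nlinarith
  have hone : ∀ m m' : ℤ, 1 = x i ^ m * h * (x j ^ m' * h')⁻¹ → x i ^ m * h = 1 := by
    intro m m' he
    have he' : x i ^ m * h = x j ^ m' * h' := (mul_inv_eq_one.1 he.symm)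
    refine hx.eq_one_of_commute hij (((Commute.refl _).zpow_left m).mul_left hc) ?_
    rw [he']
    exact ((Commute.refl _).zpow_left m').mul_left hc'
  induction k with
  | zero =>
    intro w m m' hw he
    have : w = 1 := norm_eq_zero.1 (by omega)
    rw [this, _root_.map_one] at he
    rw [hone m m' he]
    exact one_mem _
  | succ k ih =>
    intro w m m' hw he
    by_cases hw1 : w = 1
    · rw [hw1, _root_.map_one] at he
      rw [hone m m' he]
      exact one_mem _
    obtain ⟨l, hl⟩ := exists_head?_eq_some hw1
    obtain ⟨l', hl'⟩ := exists_head?_eq_some (inv_ne_one.2 hw1)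
    by_cases hli : l.1 = i
    · obtain ⟨u, hu, hun⟩ := exists_eq_mk_mul hl
      have hlet : lift (fun i => x i ^ n) (FreeGroup.mk [l]) = x i ^ (boolSign l.2 * n) := by
        have := letter_pow x n l
        rwa [letter, hli, ← zpow_natCast, ← zpow_mul] at this
      have h1 := ih u (-(boolSign l.2 * n) + m) m' (by omega) (by
        rw [hu, _root_.map_mul, hlet] at he
        rw [zpow_add, zpow_neg, mul_assoc, mul_assoc, ← mul_assoc (x i ^ m), ← he]
        group)
      have h2 : x i ^ m * h = lift (fun i => x i ^ n) (FreeGroup.mk [l]) *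
          (x i ^ (-(boolSign l.2 * n) + m) * h) := by
        rw [hlet]; group
      rw [h2]
      exact mul_mem ⟨_, rfl⟩ h1
    by_cases hlj : l'.1 = j
    · obtain ⟨u, hu, hun⟩ := exists_eq_mk_mul hl'
      have hlet : lift (fun i => x i ^ n) (FreeGroup.mk [l']) = x j ^ (boolSign l'.2 * n) := by
        have := letter_pow x n l'
        rwa [letter, hlj, ← zpow_natCast, ← zpow_mul] at this
      rw [norm_inv_eq] at hun
      refine ih u⁻¹ m (-(boolSign l'.2 * n) + m') (by rw [norm_inv_eq]; omega) ?_
      have hu' : u⁻¹ = w * FreeGroup.mk [l'] := by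
        rw [← inv_inj, mul_inv_rev, hu]; group
      rw [hu', _root_.map_mul, he, hlet]
      group
    -- Both overlaps, of `e` with `U` and of `f` with `U⁻¹`, are at most `C + 2 * R`; as `U = e *
    -- f⁻¹`, they add up to `2 * norm U`.
    exfalso
    have hlj' : i ≠ l.1 := fun h => hli h.symm
    have hli' : j ≠ l'.1 := fun h => hlj h.symm
    have h1 := hs.le_ov_lift hl
    have h2 := hs.le_ov_lift hl'
    have h3 := hx.ov_zpow_mul_le (n := n) hlj' hh m
    have h4 := hx.ov_zpow_mul_le (n := n) hli' hh' m'
    set U := lift (fun i => x i ^ n) w with hU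
    rw [_root_.map_inv, ← hU] at h2
    set e := x i ^ m * h
    set f := x j ^ m' * h'
    have h5 := min_ov_le 1 e U (letter (fun i => x i ^ n) l)
    have h6 := min_ov_le 1 f U⁻¹ (letter (fun i => x i ^ n) l')
    have h7 := hle l
    have h8 := hle l'
    have h9 := ov_le_left 1 U (letter (fun i => x i ^ n) l)
    have e1 : wd e U = norm f := by
      rw [he, wd_mul_right, norm_inv_eq]
    have e2 : wd f U⁻¹ = norm e := by
      rw [he, mul_inv_rev, inv_inv, wd_mul_right, norm_inv_eq]
    have h10 : ov 1 e U ≤ C + 2 * R := by omega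
    have h11 : ov 1 f U⁻¹ ≤ C + 2 * R := by omega
    simp only [ov, e1, e2, wd_one_left, norm_inv_eq] at h10 h11
    rw [wd_one_left] at h9
    omega

/-- The subgroup generated by large powers of the `x i` is malnormal away from the conjugates of
the powers of the `x i`. -/
theorem mem_range_of_conj [Finite α] (hx : IsIndependent x C D R)
    (hn : D + 2 * C + 2 * R + 2 < n) {w v : FreeGroup (Fin 2)} {l l' : Fin 2 × Bool}
    (hl : l.1 ≠ l'.1) (hw : HasAxisStart w l l') {g : FreeGroup α}
    (hg : g * lift (fun i => x i ^ n) w * g⁻¹ = lift (fun i => x i ^ n) v) :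
    g ∈ (lift (fun i => x i ^ n)).range := by
  have hC := hx.nonneg
  have hD := hx.nonneg'
  have hll : l ≠ l' := fun h => hl (by rw [h])
  obtain ⟨u, m, h, hc, hh, e⟩ := hx.exists_eq_mul_of_conj (by omega) hn hll hw hg
  obtain ⟨u', m', h', hc', hh', e'⟩ := hx.exists_eq_mul_of_conj (v := v⁻¹) (by omega) hn hll.symm
    hw.inv (g := g) (by rw [_root_.map_inv, _root_.map_inv, ← hg]; group)
  have h1 := hx.mem_range_of_eq_mul (n := n) (by omega) hl hh hh' hc hc' _ (u⁻¹ * u') m m' le_rfl (by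
    have e2 : lift (fun i => x i ^ n) u * (x l.1 ^ m * h) =
        lift (fun i => x i ^ n) u' * (x l'.1 ^ m' * h') := by
      rw [← mul_assoc, ← mul_assoc, ← e, ← e']
    rw [_root_.map_mul, _root_.map_inv, eq_mul_inv_iff_mul_eq, mul_assoc, ← e2]
    group)
  rw [e, mul_assoc]
  exact mul_mem ⟨u, rfl⟩ h1

/-- The axis contains the first `ballCard α (C.toNat + r)` powers of a generator. Quasiconvexity
keeps their `g`-translates near `H`, so pigeonhole conjugates a power of that generator into `H`. -/
theorem conj_notMem [Finite α] (hx : IsIndependent x C D R) {H : Subgroup (FreeGroup α)} {r : ℕ}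
    (hr : ∀ (C : ℤ) (h₁ h₂ x : FreeGroup α), h₁ ∈ H → h₂ ∈ H → ov x h₁ h₂ ≤ C →
      ∃ d ∈ H, (norm (d⁻¹ * x) : ℤ) ≤ C + r)
    (hn : ballCard α (C.toNat + r) + C < n)
    {w : FreeGroup (Fin 2)} {l l' : Fin 2 × Bool} (hl : l ≠ l') (hw : HasAxisStart w l l')
    (hH : ∀ (m : ℤ) (g : FreeGroup α), m ≠ 0 → g * x l.1 ^ m * g⁻¹ ∉ H) (g : FreeGroup α) :
    g * lift (fun i => x i ^ n) w * g⁻¹ ∉ H := by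
  intro hmem
  have hC := hx.nonneg
  have hn' : C < n := by omega
  have hs := hx.isSeparated hn'
  have hw1 : lift (fun i => x i ^ n) w ≠ 1 := by
    intro h
    exact hw.ne_one (hs.lift_injective (by rw [h, _root_.map_one]))
  obtain ⟨m, hm, h⟩ := exists_conj_pow_mem (H := H) (g := g) (x := x l.1 ^ boolSign l.2)
    (R := C.toNat + r) (by
    intro j hj
    obtain ⟨N, hN, h1⟩ := exists_pow_conj_ov_le (g := g) hw1
      (fun N hN => (hx.ov_pow_le hn' hl hw (m := j) (by omega) hN).2.2)
    obtain ⟨d, hd, h2⟩ := hr _ _ _ _ (pow_mem hmem N) (pow_mem (inv_mem hmem) N) h1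
    exact ⟨d, hd, by omega⟩)
  rw [← zpow_mul] at h
  refine hH (boolSign l.2 * m) g (mul_ne_zero ?_ hm) h
  cases l.2 <;> simp [boolSign]

end IsIndependent

/-- Pigeonhole turns non-commensurability into uniform overlap bounds. The order matters: `C` bounds
overlaps through `1`, `R` depends on `C`, and `D` handles translates by elements of norm at most
`R`. -/
theorem exists_isIndependent {α : Type*} [DecidableEq α] [Finite α] {x : Fin 2 → FreeGroup α}
    (hx1 : ∀ i, x i ≠ 1) (hx : ∀ i, IsCyclicallyReduced (x i).toWord)
    (h : ∀ i j, i ≠ j → ∀ (m k : ℤ) (g : FreeGroup α), m ≠ 0 → x i ^ m ≠ g * x j ^ k * g⁻¹) :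
    ∃ C D R, IsIndependent x C D R := by
  have hxn := fun i => norm_zpow_of_isCyclicallyReduced (hx i)
  obtain ⟨r, hr⟩ : ∃ r, ∀ i, norm (x i) ≤ r :=
    ⟨norm (x 0) + norm (x 1), fun i => by fin_cases i <;> simp⟩
  have hne : ∀ i j, i ≠ j → ∀ (m : ℤ) (g : FreeGroup α), m ≠ 0 →
      x i ^ m ∉ Subgroup.zpowers (g * x j * g⁻¹) := by
    rintro i j hij m g hm ⟨k, hk⟩
    apply h i j hij m k g hm
    rw [← hk]
    simp only [conj_zpow]
  let C : ℤ := 2 * ballCard α (2 * r) * r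
  let R : ℕ := C.toNat + r
  have hC : 0 ≤ C := by positivity
  refine ⟨C, 2 * ballCard α (2 * R) * r, R, hC, by positivity, hxn, fun i => ?_, ?_, ?_, ?_⟩
  · have : norm (x i) ≠ 0 := by simpa using hx1 i
    omega
  · intro i j hij a b
    by_contra! hlt
    obtain ⟨m, hm, h1⟩ := exists_zpow_mem_zpowers_of_lt_ov (h := 1) (z := x j) (R := r) (hxn i)
      (by simp) (hr j) (i := b) (j := a) (by
        rw [one_mul]
        refine lt_of_le_of_lt ?_ hlt
        have := hr i
        simp only [C]
        gcongr)
    exact hne i j hij m 1 hm h1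
  · intro i
    have := hr i
    simp only [R]
    omega
  · intro k i h hh a b hlt
    obtain ⟨m, hm, h1⟩ := exists_zpow_mem_zpowers_of_lt_ov (h := h) (z := x i) (R := R) (hxn k)
      hh (by have := hr i; simp only [R]; omega) (i := b) (j := a) (by
        refine lt_of_le_of_lt ?_ hlt
        have := hr k
        gcongr)
    have hki : k = i := by
      by_contra hki
      exact hne k i hki m h hm h1
    subst hki
    exact ⟨rfl, commute_of_zpow_mem_zpowers (hxn k) hm h1⟩

/-! ### The model subgroup in the free group on Y and T -/

section Pair

/-- The words `Y T³ Y` and `T Y³ T`. -/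
def pairWord (i : Fin 2) : List (Fin 2 × Bool) :=
  [(i, true), (i + 1, true), (i + 1, true), (i + 1, true), (i, true)]

/-- The elements `Y T³ Y` and `T Y³ T` of the free group on `Y` and `T`. -/
def pair (i : Fin 2) : FreeGroup (Fin 2) := mk (pairWord i)

theorem letter_pair_true (i : Fin 2) : letter pair (i, true) = mk (pairWord i) := by
  simp [letter, pair]

theorem letter_pair_false (i : Fin 2) : letter pair (i, false) = mk (invRev (pairWord i)) := by
  simp [letter, pair]

/-- The two generators and their inverses begin with four different letters, so nothing cancels and
the constant is `0`. -/
theorem isSeparated_pair : IsSeparated pair 0 where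
  nonneg := le_rfl
  lt_norm := by
    rintro ⟨i, b⟩
    cases b <;> rw [Nat.cast_pos] <;> fin_cases i <;>
    simp only [letter_pair_true, letter_pair_false] <;> decide
  ov_le := by
    rintro ⟨i, b⟩ ⟨j, c⟩ h
    rw [ov_one_eq]
    cases b <;> cases c <;> fin_cases i <;> fin_cases j <;>
    simp only [letter_pair_true, letter_pair_false] at h ⊢ <;> first | exact absurd rfl h | decide

/-- The action of `Y` (for `0`) and `T` (for `1`) on the vertices of the
Stallings graph of the subgroup generated by `Y T³ Y` and `T Y³ T`, completed by the vertices
`9, …, 12`. -/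
def stallingsPerm (i : Fin 2) : Equiv.Perm (Fin 13) where
  toFun := ![![1, 10, 11, 12, 0, 6, 7, 8, 9, 5, 4, 2, 3],
    ![5, 2, 3, 4, 9, 10, 11, 12, 0, 1, 8, 6, 7]] i
  invFun := ![![4, 0, 11, 12, 10, 9, 5, 6, 7, 8, 1, 2, 3],
    ![8, 9, 1, 2, 3, 0, 11, 12, 10, 4, 5, 6, 7]] i
  left_inv := by revert i; decide
  right_inv := by revert i; decide

/-- The end of the path with a given label starting at the base vertex. -/
def vertex (x : FreeGroup (Fin 2)) : Fin 13 :=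
  (lift (fun i => (stallingsPerm i)⁻¹) x)⁻¹ 0

theorem vertex_mul (x z : FreeGroup (Fin 2)) :
    vertex (x * z) = (lift (fun i => (stallingsPerm i)⁻¹) z)⁻¹ (vertex x) := by
  simp [vertex]

theorem vertex_mul_of (x : FreeGroup (Fin 2)) (i : Fin 2) :
    vertex (x * of i) = stallingsPerm i (vertex x) := by
  simp [vertex_mul]

theorem vertex_mk (L : List (Fin 2 × Bool)) (hL : ∀ l ∈ L, l.2 = true) :
    vertex (mk L) = L.foldl (fun v l => stallingsPerm l.1 v) 0 := by
  induction L using List.reverseRecOn with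
  | nil => rfl
  | append_singleton L l ih =>
    obtain ⟨i, b⟩ := l
    have hb : b = true := hL (i, b) (by simp)
    subst hb
    rw [← mul_mk, List.foldl_append, ← ih fun l hl => hL l (by simp [hl])]
    exact vertex_mul_of _ i

theorem vertex_mk_take (i : Fin 2) (j : ℕ) : vertex (mk ((pairWord i).take j)) =
    ((pairWord i).take j).foldl (fun v l => stallingsPerm l.1 v) 0 :=
  vertex_mk _ fun l hl => by
    have := List.mem_of_mem_take hl
    simp [pairWord] at this
    rcases this with rfl | rfl | rfl <;> rfl

theorem vertex_mul_of_mem {d : FreeGroup (Fin 2)} (hd : d ∈ (lift pair).range)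
    (x : FreeGroup (Fin 2)) : vertex (d * x) = vertex x := by
  have h0 : ∀ i, vertex (pair i) = 0 := fun i => (vertex_mk_take i 5).trans (by revert i; decide)
  have h1 : (lift pair).range ≤ (MulAction.stabilizer (Equiv.Perm (Fin 13)) (0 : Fin 13)).comap
      (lift (fun i => (stallingsPerm i)⁻¹)) := by
    rw [range_lift_eq_closure, Subgroup.closure_le]
    rintro _ ⟨i, rfl⟩
    have := h0 i
    rw [vertex, Equiv.Perm.inv_eq_iff_eq] at this
    exact this.symm
  have h2 : vertex d = 0 := by
    rw [vertex, Equiv.Perm.inv_eq_iff_eq]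
    exact (show _ = _ from h1 hd).symm
  rw [vertex_mul, h2]; rfl

/-- The points of the minimal invariant subtree of the subgroup generated by `pair`. -/
def IsPairPoint (x : FreeGroup (Fin 2)) : Prop :=
  ∃ d ∈ (lift pair).range, ∃ i, ∃ j ≤ 5, x = d * mk ((pairWord i).take j)

theorem isPairPoint_of_ov_le {h₁ h₂ x : FreeGroup (Fin 2)} (h1 : h₁ ∈ (lift pair).range)
    (h2 : h₂ ∈ (lift pair).range) (hx : ov x h₁ h₂ ≤ 0) : IsPairPoint x := by
  rw [range_lift_eq_closure] at h1 h2
  obtain ⟨d, hd, c, hc, h⟩ := exists_ov_le_of_mem_closure (C := 0) (x := x)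
    (mul_mem (inv_mem h1) h2) h1 (by simpa using hx)
  rw [← range_lift_eq_closure] at hd
  by_cases hxd : wd x d ≤ 0
  · exact ⟨d, hd, 0, 0, by omega, by rw [eq_of_wd_le hxd]; exact (mul_one d).symm⟩
  rcases hc with rfl | ⟨i, rfl⟩
  · rw [mul_one, ov_self] at h
    omega
  have e : lift of (pair i) = pair i := by rw [lift_of_eq_id]; rfl
  rw [← e] at h
  obtain ⟨L₁, l, L₂, hL, h3⟩ := exists_ov_le_letter (s := of) (pairWord i) (c := x) (P := d)
    (by omega) h
  have e1 : ∀ z : FreeGroup (Fin 2), lift of z = z := fun z => by rw [lift_of_eq_id]; rfl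
  rw [letter, e1, e1] at h3
  have h4 : wd (d * mk L₁) (d * mk L₁ * mk [l]) = 1 := by rw [wd_mul_right]; rfl
  have hlen : L₁.length + 1 ≤ 5 := by
    have := congrArg List.length hL
    simp [pairWord] at this
    omega
  simp only [ov, h4] at h3
  have h5 := wd_nonneg x (d * mk L₁)
  have h6 := wd_nonneg x (d * mk L₁ * mk [l])
  by_cases h7 : wd x (d * mk L₁) ≤ 0
  · refine ⟨d, hd, i, L₁.length, by omega, ?_⟩
    rw [hL, List.take_left, eq_of_wd_le h7]
  · refine ⟨d, hd, i, L₁.length + 1, by omega, ?_⟩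
    have : (pairWord i).take (L₁.length + 1) = L₁ ++ [l] := by
      rw [hL]; simp [List.take_append]
    rw [this, ← mul_mk, ← mul_assoc]
    exact eq_of_wd_le (by omega)

/-- A segment labelled by the central block of `pair i` occurs in the minimal subtree only in the
expected places. -/
theorem exists_eq_mul_of_isPairPoint {x : FreeGroup (Fin 2)} {i : Fin 2}
    (h : ∀ j ≤ 3, IsPairPoint (x * of (i + 1) ^ j)) : x * (of i)⁻¹ ∈ (lift pair).range := by
  have hv : ∀ x, IsPairPoint x → vertex x < 9 := by
    rintro _ ⟨d, hd, i, j, hj, rfl⟩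
    rw [vertex_mul_of_mem hd, vertex_mk_take]
    interval_cases j <;> revert i <;> decide
  obtain ⟨d, hd, k, j, hj, hx⟩ := h 0 (by omega)
  rw [pow_zero, mul_one] at hx
  have h1 := hv _ (h 1 (by omega))
  have h2 := hv _ (h 2 (by omega))
  have h3 := hv _ (h 3 (by omega))
  simp only [pow_succ, pow_zero, one_mul, ← mul_assoc, vertex_mul_of] at h1 h2 h3
  have h0 : vertex x = ((pairWord k).take j).foldl (fun v l => stallingsPerm l.1 v) 0 := by
    rw [hx, vertex_mul_of_mem hd, vertex_mk_take]
  rw [h0] at h1 h2 h3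
  -- Vertices below `9` form the actual Stallings graph; there only the start of the central block
  -- admits three consecutive steps along `i + 1`.
  have h4 : k = i ∧ j = 1 := by
    clear h0 hx h hd
    interval_cases j <;> revert k i <;> decide
  obtain ⟨rfl, rfl⟩ := h4
  rw [hx]
  have : mk ((pairWord k).take 1) = of k := rfl
  rw [this, mul_inv_cancel_right]
  exact hd

theorem exists_central_block (l : Fin 2 × Bool) : ∃ z : FreeGroup (Fin 2),
    z * (of l.1)⁻¹ ∈ (lift pair).range ∧ ∀ j ≤ 3,
      2 * (norm (z * of (l.1 + 1) ^ j) : ℤ) ≤ ov 1 (letter pair l) (z * of (l.1 + 1) ^ j) ∧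
      2 * (norm (z * of (l.1 + 1) ^ j) : ℤ) ≤ 2 * norm (letter pair l) - 0 := by
  obtain ⟨i, b⟩ := l
  cases b with
  | true =>
    refine ⟨of i, by simp, ?_⟩
    rw [letter_pair_true]
    intro j hj
    rw [ov_one_eq]
    interval_cases j <;> revert i <;> decide
  | false =>
    -- The inverse word crosses its central block backwards, so `z` is the far end of the block.
    refine ⟨(of i)⁻¹ * ((of (i + 1))⁻¹ * (of (i + 1))⁻¹ * (of (i + 1))⁻¹), ?_, ?_⟩
    · refine ⟨(of i)⁻¹, ?_⟩
      have : pair i = of i * of (i + 1) * of (i + 1) * of (i + 1) * of i := rfl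
      rw [_root_.map_inv, lift_apply_of, this]
      group
    · rw [letter_pair_false]
      intro j hj
      rw [ov_one_eq]
      interval_cases j <;> revert i <;> decide

/-- After a conjugation inside the subgroup, the axis contains a central block. Its translate lies
in the minimal subtree, where such a block determines its position up to the subgroup. -/
theorem mem_range_lift_pair_of_conj {w v g : FreeGroup (Fin 2)} (hw : w ≠ 1)
    (hg : g * lift pair w * g⁻¹ = lift pair v) : g ∈ (lift pair).range := by
  obtain ⟨c, l, l', hl, hax⟩ := exists_conj_hasAxisStart hw
  set u := c⁻¹ * w * c with hu
  set g' := g * lift pair c with hg'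
  have hconj : g' * lift pair u * g'⁻¹ = lift pair v := by
    rw [← hg, hg', hu, _root_.map_mul, _root_.map_mul, _root_.map_inv]
    group
  have hu1 : lift pair u ≠ 1 := fun h =>
    hax.ne_one (isSeparated_pair.lift_injective (by rw [h, _root_.map_one]))
  obtain ⟨z, hz, hzj⟩ := exists_central_block l
  have h1 : ∀ j ≤ 3, IsPairPoint (g' * z * of (l.1 + 1) ^ j) := by
    intro j hj
    obtain ⟨h2, h3⟩ := hzj j hj
    obtain ⟨N, -, h4⟩ := exists_pow_conj_ov_le (g := g') hu1
      (fun N hN => (isSeparated_pair.ov_pow_le hl hax h2 h3 hN).2.2)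
    rw [hconj, ← mul_assoc] at h4
    have hv : lift pair v ∈ (lift pair).range := ⟨v, rfl⟩
    exact isPairPoint_of_ov_le (pow_mem hv N) (pow_mem (inv_mem hv) N) h4
  have h2 := exists_eq_mul_of_isPairPoint h1
  have h3 : g = g' * z * (of l.1)⁻¹ * (z * (of l.1)⁻¹)⁻¹ * (lift pair c)⁻¹ := by
    rw [hg']; group
  rw [h3]
  exact mul_mem (mul_mem h2 (inv_mem hz)) (inv_mem ⟨c, rfl⟩)

theorem letter_pair_starts (l : Fin 2 × Bool) :
    2 * (norm (mk [l]) : ℤ) ≤ ov 1 (letter pair l) (mk [l]) ∧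
    2 * (norm (mk [l, (l.1 + 1, l.2)]) : ℤ) ≤ ov 1 (letter pair l) (mk [l, (l.1 + 1, l.2)]) ∧
    norm (letter pair l) = 5 ∧ norm (mk [l, (l.1 + 1, l.2)]) = 2 := by
  obtain ⟨i, b⟩ := l
  rw [ov_one_eq, ov_one_eq]
  cases b <;> simp only [letter_pair_true, letter_pair_false] <;> revert i <;> decide

/-- Nontrivial elements of the subgroup generated by `pair` have axes that pass from one generator
to the other one. -/
theorem hasAxisStart_conj_lift_pair {w : FreeGroup (Fin 2)} {l l' : Fin 2 × Bool} (hl : l ≠ l')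
    (hw : HasAxisStart w l l') :
    HasAxisStart ((mk [l])⁻¹ * lift pair w * mk [l]) (l.1 + 1, l.2) (invLetter l) := by
  intro N hN
  obtain ⟨h1, h2, h3, h4⟩ := letter_pair_starts l
  have hn1 : norm (mk [l]) = 1 := rfl
  have hn1' : norm (mk [(l.1 + 1, l.2)]) = 1 := rfl
  obtain ⟨a1, a2, -⟩ := isSeparated_pair.ov_pow_le hl hw h1 (by rw [hn1, h3]; norm_num) hN
  obtain ⟨b1, -, -⟩ := isSeparated_pair.ov_pow_le hl hw h2 (by rw [h4, h3]; norm_num) hN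
  have hA := isSeparated_pair.le_ov_lift (hw N hN).1
  have hA5 := ov_le_left 1 (lift pair (w ^ N)) (letter pair l)
  rw [_root_.map_pow] at hA hA5
  set A := lift pair w ^ N with hAdef
  have e1 : ((mk [l])⁻¹ * lift pair w * mk [l]) ^ N = (mk [l])⁻¹ * (A * mk [l]) := by
    have := conj_pow (i := N) (a := (mk [l])⁻¹) (b := lift pair w)
    rw [inv_inv] at this
    rw [this, mul_assoc]
  have e2 : ((mk [l])⁻¹ * lift pair w * mk [l])⁻¹ ^ N = (mk [l])⁻¹ * (A⁻¹ * mk [l]) := by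
    rw [inv_pow, e1]; group
  rw [inv_pow, ← hAdef] at a2
  -- Conjugation by `q` moves the base point one letter along the axis: ahead lies the other
  -- generator, behind lies the inverse of `l`.
  set q := mk [l] with hq
  have hqz : mk [l, (l.1 + 1, l.2)] = q * mk [(l.1 + 1, l.2)] := mk_cons _ _
  rw [hqz] at b1 h4
  set z := mk [(l.1 + 1, l.2)] with hzdef
  have hAq : wd (A * q) A = 1 := by rw [wd_comm, wd_mul_right, hn1]; rfl
  have hAq' : wd (A⁻¹ * q) A⁻¹ = 1 := by rw [wd_comm, wd_mul_right, hn1]; rfl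
  have hqz1 : wd q (q * z) = 1 := by rw [wd_mul_right, hn1']; rfl
  rw [wd_one_left] at hA5
  rw [h3] at hA
  constructor
  · rw [← ov_one_singleton_pos_iff, e1, ← ov_mul_left q, mul_one, mul_inv_cancel_left,
      ← hzdef]
    have m := min_ov_le q (A * q) A (q * z)
    have t1 := wd_triangle 1 q A
    have t2 := wd_triangle q (A * q) A
    simp only [ov, wd_one_left, hAq, hqz1] at a1 b1 m t1 t2 ⊢
    omega
  · rw [← ov_one_singleton_pos_iff, e2, ← ov_mul_left q, mul_one, mul_inv_cancel_left,
      ← inv_mk_singleton, ← hq, mul_inv_cancel]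
    have m := min_ov_le q (A⁻¹ * q) A⁻¹ 1
    have m' := min_ov_le 1 A q A⁻¹
    have t1 := wd_triangle 1 q A⁻¹
    have t2 := wd_triangle q (A⁻¹ * q) A⁻¹
    have hi : norm A⁻¹ = norm A := norm_inv_eq
    simp only [ov, wd_one_left, hAq', wd_comm q 1, wd_comm (A⁻¹) 1, wd_comm (A⁻¹ * q) 1,
      hi] at a1 a2 m m' t1 t2 ⊢
    omega

theorem exists_conj_hasAxisStart_lift_pair {w : FreeGroup (Fin 2)} (hw : w ≠ 1) :
    ∃ c m m', m.1 ≠ m'.1 ∧ HasAxisStart (c⁻¹ * lift pair w * c) m m' := by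
  obtain ⟨c, l, l', hl, hax⟩ := exists_conj_hasAxisStart hw
  refine ⟨lift pair c * mk [l], (l.1 + 1, l.2), invLetter l, by simp [invLetter], ?_⟩
  convert hasAxisStart_conj_lift_pair hl hax using 1
  rw [_root_.map_mul, _root_.map_mul, _root_.map_inv]
  group

end Pair

/-- The subgroup generated by `y ^ n * t ^ (3 * n) * y ^ n` and `t ^ n * y ^ (3 * n) * t ^ n`. -/
theorem closure_pair_pow_eq_range {α : Type*} (y t : FreeGroup α) (n : ℕ) :
    Subgroup.closure {y ^ n * t ^ (3 * n) * y ^ n, t ^ n * y ^ (3 * n) * t ^ n} =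
      ((lift fun i => (![y, t] i) ^ n).comp (lift pair)).range := by
  have h : (lift fun i => (![y, t] i) ^ n).comp (lift pair) =
      lift ![y ^ n * t ^ (3 * n) * y ^ n, t ^ n * y ^ (3 * n) * t ^ n] := by
    ext i
    have hp0 : pair 0 = of 0 * of 1 * of 1 * of 1 * of 0 := rfl
    have hp1 : pair 1 = of 1 * of 0 * of 0 * of 0 * of 1 := rfl
    have h3 : ∀ z : FreeGroup α, z ^ (3 * n) = z ^ n * z ^ n * z ^ n := fun z => by
      rw [← pow_add, ← pow_add]; ring_nf
    fin_cases i <;> simp [hp0, hp1, h3, mul_assoc]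
  rw [h, range_lift_eq_closure]
  congr 1
  ext z
  simp [or_comm]

/-! ### Existence of y and t -/

variable {α : Type*}

theorem nontrivial_of_not_commute {u v : FreeGroup α} (h : u * v ≠ v * u) : Nontrivial α := by
  by_contra hs
  rw [not_nontrivial_iff_subsingleton] at hs
  obtain ⟨c, hc⟩ := exists_forall_mem_zpowers α
  obtain ⟨i, rfl⟩ := hc u
  obtain ⟨j, rfl⟩ := hc v
  exact h ((Commute.refl c).zpow_zpow i j)

variable [DecidableEq α]

/-- A reduced word can be prolonged by a letter to a cyclically reduced word. -/
theorem exists_isCyclicallyReduced_append [Nontrivial α] {L : List (α × Bool)} (hL : IsReduced L) :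
    ∃ l, IsCyclicallyReduced (L ++ [l]) := by
  obtain ⟨a, b, hab⟩ := exists_pair_ne α
  have h3 : ∀ e f : α × Bool, ∃ l, l ≠ e ∧ l ≠ f := by
    intro e f
    by_contra! h
    have h1 := h (a, true)
    have h2 := h (a, false)
    have h3 := h (b, true)
    by_cases h4 : (a, true) = e
    · have h5 := h2 (by rw [← h4]; simp)
      have h6 := h3 (by rw [← h4]; simp [hab.symm])
      rw [← h5] at h6
      simp at h6
    · have h5 := h1 h4
      rw [← h5] at h2 h3
      have h6 : (a, false) = e := by
        by_contra h6
        simpa using h2 h6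
      have h7 : (b, true) = e := by
        by_contra h7
        exact hab (by simpa using (h3 h7).symm)
      rw [← h6] at h7
      simp at h7
  cases hL' : L with
  | nil => exact ⟨(a, true), by simp⟩
  | cons m M =>
    obtain ⟨l, hle, hlf⟩ := h3 (invLetter (L.getLast (by simp [hL']))) (invLetter m)
    refine ⟨l, ?_⟩
    rw [List.cons_append, ← List.cons_append, isCyclicallyReduced_cons_append_iff, ← hL']
    constructor
    · rw [IsReduced, List.isChain_append]
      refine ⟨hL, by simp, ?_⟩
      intro x hx y hy h
      rw [List.getLast?_eq_some_getLast (by simp [hL']), Option.mem_def, Option.some_inj] at hx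
      simp at hy
      subst hy
      by_contra hne
      apply hle
      rw [hx]
      ext
      · exact h.symm
      · rw [invLetter]; grind
    · intro h
      by_contra hne
      apply hlf
      ext
      · exact h
      · rw [invLetter]; grind

theorem commonPrefixLength_append_left {β : Type*} [DecidableEq β] (L M : List β) :
    commonPrefixLength (L ++ M) L = L.length := by
  induction L with
  | nil => cases M <;> simp [commonPrefixLength]
  | cons a L ih => simp [commonPrefixLength, ih]

/-- There is an element moving every coset out of a bounded neighbourhood of every `H i`. -/
theorem exists_forall_mul_notMem [Finite α] {ι : Type*} [Finite ι] {H : ι → Subgroup (FreeGroup α)}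
    (hH : ∀ i, ¬ (H i).FiniteIndex) (R : ℕ) :
    ∃ w, ∀ i f f', norm f ≤ R → norm f' ≤ R → f * w * f'⁻¹ ∉ H i := by
  by_contra! hcon
  let T := ι × {f : FreeGroup α | norm f ≤ R} × {f : FreeGroup α | norm f ≤ R}
  have : Finite {f : FreeGroup α | norm f ≤ R} := (finite_norm_le R).to_subtype
  have := Fintype.ofFinite T
  -- Otherwise finitely many cosets of the conjugates `f'⁻¹ H f'` cover the group, and by Neumann's
  -- lemma one of these has finite index.
  obtain ⟨⟨i, f, f'⟩, -, h⟩ := Subgroup.exists_finiteIndex_of_leftCoset_cover (s := Finset.univ)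
    (H := fun k : T => (H k.1).comap (MulAut.conj k.2.2.1).toMonoidHom)
    (g := fun k : T => k.2.1.1⁻¹ * k.2.2.1) (by
      rw [Set.eq_univ_iff_forall]
      intro w
      obtain ⟨i, f, f', hf, hf', h⟩ := hcon w
      simp only [Set.mem_iUnion]
      refine ⟨(i, ⟨f, hf⟩, ⟨f', hf'⟩), Finset.mem_univ _, ?_⟩
      rw [mem_leftCoset_iff]
      simpa [mul_assoc] using h)
  apply hH i
  rw [Subgroup.finiteIndex_iff] at h ⊢
  rwa [Subgroup.index_comap_of_surjective _ (MulAut.conj f'.1).surjective] at h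

/-- There is a cyclically reduced element no power of which is conjugate into one of finitely many
finitely generated subgroups of infinite index. -/
theorem exists_isAdmissibleFirst [Finite α] [Nontrivial α] {k : ℕ}
    {H : Fin k → Subgroup (FreeGroup α)} (hfg : ∀ i, (H i).FG)
    (hindex : ∀ i, ¬ (H i).FiniteIndex) : ∃ y, IsAdmissibleFirst H y := by
  choose r hr using fun i => exists_norm_le_of_fg (hfg i)
  let R := Finset.univ.sup r
  obtain ⟨w, hw⟩ := exists_forall_mul_notMem hindex R
  obtain ⟨l, hl⟩ := exists_isCyclicallyReduced_append (isReduced_toWord (x := w))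
  -- Now `1` and `w` both lie on the axis of `y`. If `g` conjugated a power of `y` into `H j`, both
  -- `g` and `g * w` would be within `R` of `H j`, against the choice of `w`.
  set y : FreeGroup α := mk (w.toWord ++ [l]) with hy
  have hyw : y.toWord = w.toWord ++ [l] := by rw [hy, toWord_mk, hl.isReduced.reduce_eq]
  have hy1 : y ≠ 1 := by
    intro h
    rw [h] at hyw
    simp at hyw
  have hcyc : IsCyclicallyReduced y.toWord := hyw ▸ hl
  obtain ⟨m, m', hm, -, hax⟩ := exists_hasAxisStart_of_isCyclicallyReduced hy1 hcyc
  have hov1 : ∀ N : ℕ, 1 ≤ N → ov 1 (y ^ N) (y⁻¹ ^ N) ≤ 0 := by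
    intro N hN
    obtain ⟨h1, h2⟩ := hax N hN
    rw [← ov_one_singleton_pos_iff] at h1
    by_contra! h
    have h3 := min_ov_le 1 (y⁻¹ ^ N) (y ^ N) (mk [m])
    rw [ov_comm 1 (y⁻¹ ^ N) (y ^ N)] at h3
    have h4 := ov_one_singleton_pos_iff.1 (lt_of_lt_of_le (lt_min h h1) h3)
    rw [h2] at h4
    exact hm (by simpa using h4.symm)
  have hovw : ∀ N : ℕ, 1 ≤ N → ov w (y ^ N) (y⁻¹ ^ N) ≤ 0 := by
    intro N hN
    refine ov_le_of_prefix ?_ (hov1 N hN)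
    obtain ⟨N, rfl⟩ : ∃ M, N = M + 1 := ⟨N - 1, by omega⟩
    rw [ov_one_eq, toWord_pow, (hcyc.flatten_replicate (N + 1)).isReduced.reduce_eq,
      List.replicate_succ, List.flatten_cons, hyw, List.append_assoc,
      commonPrefixLength_append_left]
    rfl
  have key : ∀ (i : ℕ) (j : Fin k) (g : FreeGroup α), i ≠ 0 → g * y ^ i * g⁻¹ ∉ H j := by
    intro i j g hi hmem
    have hyi : y ^ i ≠ 1 := by
      intro h
      exact hy1 (pow_left_injective hi (by simpa using h))
    have hnear : ∀ q, (∀ N : ℕ, 1 ≤ N → ov q (y ^ N) (y⁻¹ ^ N) ≤ 0) →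
        ∃ d ∈ H j, norm (d⁻¹ * (g * q)) ≤ R := by
      intro q hq
      obtain ⟨N, hN, h1⟩ := exists_pow_conj_ov_le (u := y ^ i) (g := g) (q := q) (C := 0) hyi
        (fun N hN => by
          have := hq (i * N) (Nat.mul_pos (Nat.pos_of_ne_zero hi) hN)
          rwa [pow_mul, pow_mul, inv_pow y i] at this)
      obtain ⟨d, hd, h2⟩ := hr j 0 _ _ _ (pow_mem hmem N) (pow_mem (inv_mem hmem) N) h1
      refine ⟨d, hd, ?_⟩
      have : r j ≤ R := Finset.le_sup (Finset.mem_univ j)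
      omega
    obtain ⟨d, hd, h1⟩ := hnear 1 hov1
    obtain ⟨d', hd', h2⟩ := hnear w hovw
    refine hw j _ _ h1 h2 ?_
    have e : d⁻¹ * (g * 1) * w * (d'⁻¹ * (g * w))⁻¹ = d⁻¹ * d' := by group
    rw [e]
    exact mul_mem (inv_mem hd) hd'
  refine ⟨y, hy1, hcyc, fun i hi h hh hconj => ?_⟩
  obtain ⟨j, hj⟩ := Set.mem_iUnion.1 hh
  obtain ⟨c, hc⟩ := isConj_iff.1 hconj
  obtain ⟨n, rfl | rfl⟩ := i.eq_nat_or_neg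
  · refine key n j c (by simpa using hi) ?_
    rw [zpow_natCast] at hc
    rw [hc]; exact hj
  · refine key n j c (by simpa using hi) ?_
    have e : c * y ^ n * c⁻¹ = h⁻¹ := by
      rw [← hc, zpow_neg, zpow_natCast]; group
    rw [e]; exact inv_mem hj

/-- The exponent sum of a letter. -/
def expSum (a : α) : FreeGroup α →* Multiplicative ℤ :=
  lift fun b => Multiplicative.ofAdd (if b = a then 1 else 0)

theorem expSum_eq_of_isConj (a : α) {u v : FreeGroup α} (h : IsConj u v) :
    expSum a u = expSum a v :=
  isConj_iff_eq.1 ((expSum a).map_isConj h)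

/-- If `of a` and `of b` both failed, the first would force the exponent sum of `b` in `y` to vanish
and the second would forbid it. -/
theorem exists_isAdmissibleSecond [Nontrivial α] (y : FreeGroup α) :
    ∃ t, IsAdmissibleSecond y t := by
  obtain ⟨a, b, hab⟩ := exists_pair_ne α
  by_contra! h
  have key : ∀ c, ∃ i j : ℤ, i ≠ 0 ∧ IsConj (of c ^ i) (y ^ j) := by
    intro c
    by_contra! hc
    exact h (of c) ⟨by simp [toWord_of], hc⟩
  obtain ⟨i, j, hi, h1⟩ := key a
  obtain ⟨i', j', hi', h2⟩ := key b
  have e1 := congrArg Multiplicative.toAdd (expSum_eq_of_isConj a h1)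
  have e2 := congrArg Multiplicative.toAdd (expSum_eq_of_isConj b h1)
  have e3 := congrArg Multiplicative.toAdd (expSum_eq_of_isConj b h2)
  simp [expSum, hab] at e1 e2 e3
  rcases e2 with rfl | e2
  · simp at e1; exact hi e1
  · rw [e2] at e3; simp at e3; exact hi' e3

/-! ### Transfer from the model subgroup to gp(a, b) -/

theorem isMalnormalPairFor [Finite α] {C D : ℤ} {R n k : ℕ} {H : Fin k → Subgroup (FreeGroup α)}
    {y t : FreeGroup α} (hx : IsIndependent ![y, t] C D R) (hn : D + 2 * C + 2 * R + 2 < n)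
    {r : Fin k → ℕ}
    (hr : ∀ i (C : ℤ) (h₁ h₂ x : FreeGroup α), h₁ ∈ H i → h₂ ∈ H i → ov x h₁ h₂ ≤ C →
      ∃ d ∈ H i, (norm (d⁻¹ * x) : ℤ) ≤ C + r i)
    (hnr : ∀ i, ballCard α (C.toNat + r i) + C < n)
    (hH : ∀ (i : Fin k) (m : ℤ) (g : FreeGroup α), m ≠ 0 → g * y ^ m * g⁻¹ ∉ H i) :
    IsMalnormalPairFor H (y ^ n * t ^ (3 * n) * y ^ n) (t ^ n * y ^ (3 * n) * t ^ n) := by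
  have hC := hx.nonneg
  have hD := hx.nonneg'
  have hs := hx.isSeparated (n := n) (by omega)
  unfold IsMalnormalPairFor
  rw [closure_pair_pow_eq_range]
  set ψ : FreeGroup (Fin 2) →* FreeGroup α := lift fun i => (![y, t] i) ^ n with hψ
  have hinj : Function.Injective ψ := hs.lift_injective
  have hinj' : Function.Injective (ψ.comp (lift pair)) :=
    hinj.comp isSeparated_pair.lift_injective
  refine ⟨⟨FreeGroupBasis.ofRepr (MonoidHom.ofInjective hinj').symm⟩, ?_, ?_⟩
  · intro g hg
    rw [eq_bot_iff]
    rintro _ ⟨⟨_, ⟨w, rfl⟩, rfl⟩, ⟨v, hv⟩⟩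
    by_cases hw : w = 1
    · rw [hw]; simp
    exfalso
    apply hg
    obtain ⟨c, m, m', hm, hax⟩ := exists_conj_hasAxisStart_lift_pair hw
    have hv' : g * ψ (lift pair w) * g⁻¹ = ψ (lift pair v) := hv.symm
    obtain ⟨u, hu⟩ := hx.mem_range_of_conj (n := n) (v := lift pair v) (g := g * ψ c) hn hm hax (by
      rw [← hψ, ← hv', _root_.map_mul, _root_.map_mul, _root_.map_inv]
      group)
    have hg' : g = ψ (u * c⁻¹) := by
      rw [_root_.map_mul, hu, _root_.map_inv]; group
    obtain ⟨d, hd⟩ := mem_range_lift_pair_of_conj (g := u * c⁻¹) (v := v) hw (hinj (by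
      rw [_root_.map_mul, _root_.map_mul, _root_.map_inv, ← hg', hv']))
    exact ⟨d, by rw [hg', ← hd]; rfl⟩
  · rintro _ ⟨w, rfl⟩ hw1 h hh hconj
    have hw : w ≠ 1 := by
      rintro rfl
      simp at hw1
    obtain ⟨i, hi⟩ := Set.mem_iUnion.1 hh
    obtain ⟨a, ha⟩ := isConj_iff.1 hconj
    change a * ψ (lift pair w) * a⁻¹ = h at ha
    obtain ⟨c, m, m', hm, hax⟩ := exists_conj_hasAxisStart_lift_pair hw
    have hmm : m ≠ m' := fun h => hm (by rw [h])
    have hy : ∀ l : Fin 2 × Bool, l.1 = 0 → ∀ (m : ℤ) (g : FreeGroup α), m ≠ 0 →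
        g * (![y, t] l.1) ^ m * g⁻¹ ∉ H i := by
      intro l hl
      rw [hl]
      exact hH i
    have e : (a * ψ c) * ψ (c⁻¹ * lift pair w * c) * (a * ψ c)⁻¹ = h := by
      rw [← ha, _root_.map_mul, _root_.map_mul, _root_.map_inv]
      group
    -- The axis reads different generators in its two directions, so one of them reads `y`;
    -- inverting the element selects that direction, and nothing about `t` and `H i` is needed.
    have h01 : m.1 = 0 ∨ m'.1 = 0 := by omega
    rcases h01 with h0 | h0
    · refine hx.conj_notMem (hr i) (hnr i) hmm hax (hy m h0) (a * ψ c) ?_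
      rw [← hψ, e]
      exact hi
    · refine hx.conj_notMem (hr i) (hnr i) hmm.symm hax.inv (hy m' h0) (a * ψ c) ?_
      rw [← hψ, _root_.map_inv, ← conj_inv, e]
      exact inv_mem hi

theorem exists_forall_isMalnormalPairFor [Finite α] {k : ℕ} {H : Fin k → Subgroup (FreeGroup α)}
    (hfg : ∀ i, (H i).FG) {y t : FreeGroup α} (hy : IsAdmissibleFirst H y)
    (ht : IsAdmissibleSecond y t) :
    ∃ M : ℕ, ∀ n : ℕ, M ≤ n →
      IsMalnormalPairFor H (y ^ n * t ^ (3 * n) * y ^ n) (t ^ n * y ^ (3 * n) * t ^ n) := by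
  obtain ⟨hy1, hyc, hyH⟩ := hy
  obtain ⟨htc, hty⟩ := ht
  have ht1 : t ≠ 1 := by
    rintro rfl
    exact hty 1 0 one_ne_zero (by simp)
  obtain ⟨C, D, R, hx⟩ := exists_isIndependent (x := ![y, t])
    (by intro i; fin_cases i <;> assumption) (by intro i; fin_cases i <;> assumption) (by
      intro i j hij m k g hm h
      have hconj : IsConj (![y, t] j ^ k) (![y, t] i ^ m) := isConj_iff.2 ⟨g, h.symm⟩
      fin_cases i <;> fin_cases j
      · exact hij rfl
      · refine hty k m ?_ hconj
        rintro rfl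
        have : y ^ m = 1 := by simpa using h
        exact hy1 (zpow_left_injective hm (by simpa using this))
      · exact hty m k hm hconj.symm
      · exact hij rfl)
  choose r hr using fun i => exists_norm_le_of_fg (hfg i)
  refine ⟨(D + 2 * C + 2 * R).toNat + 3 +
    Finset.univ.sup fun i => ballCard α (C.toNat + r i) + C.toNat + 1, fun n hn => ?_⟩
  refine isMalnormalPairFor hx (by omega) hr (fun i => ?_) fun i m g hm hmem => ?_
  · have : ballCard α (C.toNat + r i) + C.toNat + 1 ≤
        Finset.univ.sup fun i => ballCard α (C.toNat + r i) + C.toNat + 1 :=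
      Finset.le_sup (f := fun i => ballCard α (C.toNat + r i) + C.toNat + 1) (Finset.mem_univ i)
    omega
  · exact hyH m hm _ (Set.mem_iUnion.2 ⟨i, hmem⟩) (isConj_iff.2 ⟨g, rfl⟩)

end FreeGroup

theorem theoremC {X : Type*} [Finite X] [DecidableEq X]
    (hX : ∃ u v : FreeGroup X, u * v ≠ v * u)
    {k : ℕ} (H : Fin k → Subgroup (FreeGroup X))
    (hfg : ∀ i, (H i).FG) (hindex : ∀ i, ¬ (H i).FiniteIndex) :
    (∃ a b : FreeGroup X, IsMalnormalPairFor H a b) ∧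
    (∃ y : FreeGroup X, IsAdmissibleFirst H y) ∧
    (∀ y : FreeGroup X, IsAdmissibleFirst H y →
      (∃ t : FreeGroup X, IsAdmissibleSecond y t) ∧
      ∀ t : FreeGroup X, IsAdmissibleSecond y t →
        ∃ M : ℕ, ∀ n : ℕ, M ≤ n →
          IsMalnormalPairFor H (y ^ n * t ^ (3 * n) * y ^ n) (t ^ n * y ^ (3 * n) * t ^ n)) := by
  obtain ⟨u, v, huv⟩ := hX
  have := FreeGroup.nontrivial_of_not_commute huv
  obtain ⟨y, hy⟩ := FreeGroup.exists_isAdmissibleFirst hfg hindex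
  obtain ⟨t, ht⟩ := FreeGroup.exists_isAdmissibleSecond y
  obtain ⟨M, hM⟩ := FreeGroup.exists_forall_isMalnormalPairFor hfg hy ht
  exact ⟨⟨_, _, hM M le_rfl⟩, ⟨y, hy⟩, fun y hy => ⟨FreeGroup.exists_isAdmissibleSecond y,
    fun t ht => FreeGroup.exists_forall_isMalnormalPairFor hfg hy ht⟩⟩
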